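/- Let $M$ be a connected, paracompact, Hausdorff smooth manifold of dimension $D=r+s\ge 3$, with an orientation and a smooth pseudo-Riemannian metric $g$ of signature $(r,s)$; put $\eta=\mathrm{diag}(1,\dots,1,-1,\dots,-1)$ ($r$ times $1$, $s$ times $-1$) and $d_\gamma=2^{\lfloor D/2\rfloor}$. Let $\mathrm{Spin}(r,s)$ be the group of products of an even number of vectors of square length $\pm1$ in the real Clifford algebra of $(\mathbb R^{D},\eta)$ (convention $v\cdot v=-\langle v,v\rangle$), with covering $\Pi:\mathrm{Spin}(r,s)\to \mathrm{SO}(r,s)$, $\widehat{\Pi(h)v}=h\hat v h^{-1}$, and let $\mathrm{Spin}^{\mathbb C}(r,s)=(\mathrm{Spin}(r,s)\times \mathrm U(1))/\{\pm(1,1)\}$. Let $\mathrm{SO}(M)$ be the bundle of oriented pseudo-orthonormal frames. A spin structure is a smooth principal $\mathrm{Spin}(r,s)$-bundle $P\to M$ with a smooth bundle map $\Phi:P\to \mathrm{SO}(M)$ over $M$ such that $\Phi(ph)=\Phi(p)\Pi(h)$; a $\mathrm{Spin}^{\mathbb C}$ structure is a smooth principal $\mathrm{Spin}^{\mathbb C}(r,s)$-bundle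 $P\to M$, a smooth principal $\mathrm U(1)$-bundle $L\to M$ and a smooth bundle map $(\Phi,\Psi):P\to \mathrm{SO}(M)\times_M L$ equivariant with respect to $[(h,u)]\mapsto(\Pi(h),u^2)$. A set of Dirac matrices is a family $\Gamma_1,\dots,\Gamma_D$ of complex $d_\gamma\times d_\gamma$ matrices with $\Gamma_a\Gamma_b+\Gamma_b\Gamma_a=-2\eta_{ab}\mathbb 1$. It defines a representation $\rho_\Gamma$ of $\mathrm{Spin}(r,s)$, hence of $\mathrm{Spin}^{\mathbb C}(r,s)$ by $[(h,u)]\mapsto u\,\rho_\Gamma(h)$, on $\mathbb C^{d_\gamma}$, and the spinor bundle $E_\Gamma=P\times_{\rho_\Gamma}\mathbb C^{d_\gamma}$, whose elements are the classes $[p,v]$ with $[ph,v]=[p,\rho_\Gamma(h)v]$. A Dirac structure on $E_\Gamma$ is a smooth section $\gamma$ of $T^*M\otimes\mathrm{End}(E_\Gamma)$ with $\gamma(X)\gamma(Y)+\gamma(Y)\gamma(X)=-2g(X,Y)\mathbb 1$. A section $\gamma$ is given by constant matrices $\Delta_1,\dots,\Delta_D$ in the spin frames if $\gamma(e_a)[p,v]=[p,\Delta_a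 v]$ for all $p\in P$, all $v$ and all $a$, where $(e_1,\dots,e_D)=\Phi(p)$; it is called natural if it is a Dirac structure given in the spin frames by some constant matrices. Theorem. Sets of Dirac matrices exist. Let a Spin or $\mathrm{Spin}^{\mathbb C}$ structure on $(M,g)$ be given. 1. (Existence) For every set of Dirac matrices $\Gamma$ there is exactly one section $\gamma$ of $T^*M\otimes \mathrm{End}(E_\Gamma)$ given in all spin frames by the constant matrices $\Gamma_a$, and it is a Dirac structure. 2. (Uniqueness) Let $\Gamma,\Gamma'$ be sets of Dirac matrices, and let $\gamma$ and $\gamma'$ be natural Dirac structures on $E_\Gamma$ and $E_{\Gamma'}$. Then there are $S\in\mathrm{GL}(d_\gamma,\mathbb C)$ and $\varepsilon\in\{1,-1\}$, with $\varepsilon=1$ if $D$ is even, such that $T:[p,v]\mapsto[p,Sv]$ is a well-defined isomorphism $E_\Gamma\to E_{\Gamma'}$ and $\gamma'(X)=\varepsilon\,T\gamma(X)T^{-1}$ for all $X$. (The case $\Gamma=\Gamma'$ is the uniqueness on a fixed spinor bundle.) 3. (Sign) If $D$ is odd and $\gamma$ is a natural Dirac structure on $E_\Gamma$, then so is $-\gamma$,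 and at no point $x\in M$ is there an invertible $T\in\mathrm{End}((E_\Gamma)_x)$ with $-\gamma_x(X)=T\gamma_x(X)T^{-1}$ for all $X\in T_xM$. -/

import Mathlib

open scoped Manifold ContDiff Matrix

universe u v w w'

noncomputable section

/-! ## The flat model: signature, Clifford algebra, Spin, Spin^c, Dirac matrices -/

section Flat

/-- The diagonal entries of the standard form of signature `(r, s)`: `r` entries `1`, then `s`
entries `-1`. -/
def etaSign (r s : ℕ) (a : Fin (r + s)) : ℝ := if (a : ℕ) < r then 1 else -1

/-- The standard form `η = diag (1, …, 1, -1, …, -1)` as a matrix. -/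
def eta (r s : ℕ) : Matrix (Fin (r + s)) (Fin (r + s)) ℝ := Matrix.diagonal (etaSign r s)

/-- The standard scalar product `⟨v, v⟩ = ∑ η_aa v_a²` as a quadratic form. -/
def etaForm (r s : ℕ) : QuadraticForm ℝ (Fin (r + s) → ℝ) :=
  QuadraticMap.weightedSumSquares ℝ (etaSign r s)

/-- The real Clifford algebra `Cl(r, s)` with the sign convention `v * v = - ⟨v, v⟩`. -/
abbrev Cl (r s : ℕ) : Type := CliffordAlgebra (-etaForm r s)

/-- The canonical inclusion of `ℝ^(r+s)` in `Cl(r, s)`. -/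
def clι (r s : ℕ) : (Fin (r + s) → ℝ) →ₗ[ℝ] Cl r s := CliffordAlgebra.ι (-etaForm r s)

lemma clι_injective (r s : ℕ) : Function.Injective (clι r s) := by
  intro v w h
  have h' := congrArg (CliffordAlgebra.equivExterior (-etaForm r s)) h
  have key : ∀ u : Fin (r + s) → ℝ, CliffordAlgebra.equivExterior (-etaForm r s) (clι r s u)
      = ExteriorAlgebra.ι ℝ u := fun u => by
    exact CliffordAlgebra.changeForm_ι CliffordAlgebra.changeForm.associated_neg_proof u
  rw [key, key] at h'
  exact ExteriorAlgebra.ι_leftInverse (R := ℝ).injective h'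

/-- `Spin(r, s)`: all products of an even number of vectors `v` with `⟨v, v⟩ = ± 1`
in the Clifford algebra. (The generating set is closed under inversion, so the subgroup that it
generates is the set of products.) -/
def Spin (r s : ℕ) : Subgroup (Cl r s)ˣ :=
  Subgroup.closure {u | ∃ v w : Fin (r + s) → ℝ,
    (etaForm r s v = 1 ∨ etaForm r s v = -1) ∧ (etaForm r s w = 1 ∨ etaForm r s w = -1) ∧
    (u : Cl r s) = clι r s v * clι r s w}

lemma spin_le_lipschitz (r s : ℕ) : Spin r s ≤ lipschitzGroup (-etaForm r s) := by
  unfold Spin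
  rw [Subgroup.closure_le]
  rintro u ⟨v, w, hv, hw, hu⟩
  have unit : ∀ x : Fin (r + s) → ℝ, (etaForm r s x = 1 ∨ etaForm r s x = -1) →
      ∃ y : (Cl r s)ˣ, (y : Cl r s) = clι r s x := by
    intro x hx
    have h : IsUnit (clι r s x) := by
      refine CliffordAlgebra.isUnit_ι_of_isUnit (-etaForm r s) (m := x) ?_
      rcases hx with hx | hx <;> simp [hx]
    exact ⟨h.unit, rfl⟩
  obtain ⟨v', hv'⟩ := unit v hv
  obtain ⟨w', hw'⟩ := unit w hw
  have : u = v' * w' := Units.ext (by rw [hu, Units.val_mul, hv', hw'])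
  rw [this]
  exact Subgroup.mul_mem _ (Subgroup.subset_closure ⟨v, hv'.symm⟩)
    (Subgroup.subset_closure ⟨w, hw'.symm⟩)

lemma spin_conj_mem (r s : ℕ) (g : Spin r s) (v : Fin (r + s) → ℝ) :
    ∃ w, clι r s w = (g : (Cl r s)ˣ) * clι r s v * ((g : (Cl r s)ˣ)⁻¹ : (Cl r s)ˣ) := by
  have := lipschitzGroup.conjAct_smul_ι_mem_range_ι (spin_le_lipschitz r s g.2) v
  rwa [ConjAct.units_smul_def, ConjAct.ofConjAct_toConjAct] at this

/-- The vector `Π(g) v`, characterised by `(Π(g) v)^ = g v^ g⁻¹` in the Clifford algebra. -/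
def spinCoverFun (r s : ℕ) (g : Spin r s) (v : Fin (r + s) → ℝ) : Fin (r + s) → ℝ :=
  (spin_conj_mem r s g v).choose

lemma spinCoverFun_spec (r s : ℕ) (g : Spin r s) (v : Fin (r + s) → ℝ) :
    clι r s (spinCoverFun r s g v)
      = (g : (Cl r s)ˣ) * clι r s v * ((g : (Cl r s)ˣ)⁻¹ : (Cl r s)ˣ) :=
  (spin_conj_mem r s g v).choose_spec

/-- The covering homomorphism `Π`, from `Spin(r, s)` to the linear maps of `ℝ^(r+s)`;
its image is `SO(r, s)`. -/
def spinCover (r s : ℕ) : Spin r s →* Module.End ℝ (Fin (r + s) → ℝ) where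
  toFun g :=
    { toFun := spinCoverFun r s g
      map_add' := fun v w => clι_injective r s (by
        simp only [spinCoverFun_spec, map_add, mul_add, add_mul])
      map_smul' := fun c v => clι_injective r s (by
        simp only [spinCoverFun_spec, map_smul, RingHom.id_apply, mul_smul_comm,
          smul_mul_assoc]) }
  map_one' := LinearMap.ext fun v => clι_injective r s (by
    simp [spinCoverFun_spec])
  map_mul' g h := LinearMap.ext fun v => clι_injective r s (by
    simp [spinCoverFun_spec, mul_assoc])

/-- The subgroup `ℤ₂ = {(1, 1), (-1, -1)}` of `Spin(r, s) × U(1)`. -/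
def spinCKernel (r s : ℕ) : Subgroup (Spin r s × Circle) where
  carrier := {p | (((p.1 : (Cl r s)ˣ) : Cl r s) = 1 ∧ p.2 = 1) ∨
    (((p.1 : (Cl r s)ˣ) : Cl r s) = -1 ∧ p.2 = -1)}
  one_mem' := Or.inl ⟨rfl, rfl⟩
  mul_mem' := by
    rintro ⟨a, u⟩ ⟨b, v⟩ h h'
    change ((a : (Cl r s)ˣ) : Cl r s) = 1 ∧ u = 1 ∨ ((a : (Cl r s)ˣ) : Cl r s) = -1 ∧ u = -1 at h
    change ((b : (Cl r s)ˣ) : Cl r s) = 1 ∧ v = 1 ∨ ((b : (Cl r s)ˣ) : Cl r s) = -1 ∧ v = -1 at h'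
    change ((a : (Cl r s)ˣ) : Cl r s) * ((b : (Cl r s)ˣ) : Cl r s) = 1 ∧ u * v = 1 ∨
      ((a : (Cl r s)ˣ) : Cl r s) * ((b : (Cl r s)ˣ) : Cl r s) = -1 ∧ u * v = -1
    rcases h with ⟨h₁, h₂⟩ | ⟨h₁, h₂⟩ <;> rcases h' with ⟨h₃, h₄⟩ | ⟨h₃, h₄⟩ <;>
      rw [h₁, h₂, h₃, h₄] <;> simp
  inv_mem' := by
    rintro ⟨a, u⟩ (⟨h₁, h₂⟩ | ⟨h₁, h₂⟩)
    · left
      have ha : (a : (Cl r s)ˣ) = 1 := Units.ext h₁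
      simp_all
    · right
      have ha : (a : (Cl r s)ˣ) = -1 := Units.ext (by simpa using h₁)
      simp_all

instance spinCKernel_normal (r s : ℕ) : (spinCKernel r s).Normal where
  conj_mem := by
    rintro ⟨a, u⟩ h ⟨b, v⟩
    rcases h with ⟨h₁, h₂⟩ | ⟨h₁, h₂⟩
    · left
      have ha : (a : (Cl r s)ˣ) = 1 := Units.ext h₁
      simp_all
    · right
      have ha : (a : (Cl r s)ˣ) = -1 := Units.ext (by simpa using h₁)
      simp_all

/-- `Spin^c(r, s) = (Spin(r, s) × U(1)) / ℤ₂`. -/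
abbrev SpinC (r s : ℕ) : Type := (Spin r s × Circle) ⧸ spinCKernel r s

/-- The class `[(g, u)]` in `Spin^c(r, s)`. -/
def SpinC.mk (r s : ℕ) : Spin r s × Circle →* SpinC r s := QuotientGroup.mk' (spinCKernel r s)

/-- The homomorphism `[(g, u)] ↦ Π(g)`, from `Spin^c(r, s)` onto `SO(r, s)`. -/
def spinCCover (r s : ℕ) : SpinC r s →* Module.End ℝ (Fin (r + s) → ℝ) :=
  QuotientGroup.lift (spinCKernel r s) ((spinCover r s).comp (MonoidHom.fst _ _)) (by
    rintro ⟨a, u⟩ h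
    refine LinearMap.ext fun v => clι_injective r s ?_
    change clι r s (spinCoverFun r s a v) = clι r s v
    rw [spinCoverFun_spec]
    rcases h with ⟨h₁, -⟩ | ⟨h₁, -⟩
    · have ha : (a : (Cl r s)ˣ) = 1 := Units.ext h₁
      simp [ha]
    · have ha : (a : (Cl r s)ˣ) = -1 := Units.ext (by simpa using h₁)
      simp [ha])

/-- The homomorphism `[(g, u)] ↦ u²`, from `Spin^c(r, s)` onto `U(1)`. -/
def spinCSq (r s : ℕ) : SpinC r s →* Circle :=
  QuotientGroup.lift (spinCKernel r s) ((powMonoidHom 2).comp (MonoidHom.snd _ _)) (by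
    rintro ⟨a, u⟩ (⟨-, h₂⟩ | ⟨-, h₂⟩) <;> simp_all)

/-- The dimension `d_γ = 2^⌊D/2⌋` of the spinor space, where `D = r + s`. -/
abbrev dγ (r s : ℕ) : ℕ := 2 ^ ((r + s) / 2)

/-- A set of constant Dirac matrices `Γ_a` of size `d_γ × d_γ`: `{Γ_a, Γ_b} = -2 η_ab 1`. -/
def IsDiracMatrices (r s : ℕ) (Γ : Fin (r + s) → Matrix (Fin (dγ r s)) (Fin (dγ r s)) ℂ) : Prop :=
  ∀ a b, Γ a * Γ b + Γ b * Γ a = (-2 * eta r s a b) • (1 : Matrix (Fin (dγ r s)) (Fin (dγ r s)) ℂ)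

/-- The type of all sets of constant Dirac matrices. -/
def DiracMatrices (r s : ℕ) : Type :=
  {Γ : Fin (r + s) → Matrix (Fin (dγ r s)) (Fin (dγ r s)) ℂ // IsDiracMatrices r s Γ}

namespace DiracMatrices

variable {r s : ℕ}

/-- The linear map `v ↦ ∑ v_a Γ_a`. -/
def slash (Γ : DiracMatrices r s) :
    (Fin (r + s) → ℝ) →ₗ[ℝ] Matrix (Fin (dγ r s)) (Fin (dγ r s)) ℂ where
  toFun v := ∑ a, v a • Γ.1 a
  map_add' v w := by simp [add_smul, Finset.sum_add_distrib]
  map_smul' c v := by simp [mul_smul, Finset.smul_sum]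

lemma slash_mul_self (Γ : DiracMatrices r s) (v : Fin (r + s) → ℝ) :
    Γ.slash v * Γ.slash v = algebraMap ℝ _ ((-etaForm r s) v) := by
  have h2 : (2 : ℝ) • (Γ.slash v * Γ.slash v)
      = (2 : ℝ) • algebraMap ℝ (Matrix (Fin (dγ r s)) (Fin (dγ r s)) ℂ) ((-etaForm r s) v) := by
    have e1 : Γ.slash v * Γ.slash v = ∑ a, ∑ b, (v a * v b) • (Γ.1 a * Γ.1 b) := by
      simp [slash, Finset.sum_mul_sum, smul_smul, mul_comm]
    have e2 : Γ.slash v * Γ.slash v = ∑ a, ∑ b, (v a * v b) • (Γ.1 b * Γ.1 a) := by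
      rw [e1, Finset.sum_comm]
      refine Finset.sum_congr rfl fun a _ => Finset.sum_congr rfl fun b _ => ?_
      rw [mul_comm (v b)]
    rw [two_smul]
    conv_lhs => rw [e1]
    conv_lhs => enter [2]; rw [← e1, e2]
    rw [← Finset.sum_add_distrib]
    simp_rw [← Finset.sum_add_distrib, ← smul_add]
    have : ∀ a b, Γ.1 a * Γ.1 b + Γ.1 b * Γ.1 a
      = (-2 * eta r s a b) • (1 : Matrix (Fin (dγ r s)) (Fin (dγ r s)) ℂ) := Γ.2
    simp_rw [this, smul_smul]
    simp_rw [← Finset.sum_smul]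
    rw [Algebra.algebraMap_eq_smul_one, smul_smul]
    congr 1
    simp only [eta, Matrix.diagonal_apply, neg_apply, etaForm,
      QuadraticMap.weightedSumSquares_apply, mul_ite, mul_zero, Finset.sum_ite_eq,
      Finset.mem_univ, if_true, smul_eq_mul, mul_neg, Finset.mul_sum, ← Finset.sum_neg_distrib]
    refine Finset.sum_congr rfl fun a _ => ?_
    ring
  exact smul_right_injective _ (two_ne_zero) h2

/-- The representation of the Clifford algebra on `ℂ^d_γ` defined by the matrices `Γ`. -/
def cliffordRep (Γ : DiracMatrices r s) :
    Cl r s →ₐ[ℝ] Matrix (Fin (dγ r s)) (Fin (dγ r s)) ℂ :=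
  CliffordAlgebra.lift _ ⟨Γ.slash, Γ.slash_mul_self⟩

/-- The restriction of the Clifford representation to `Spin(r, s)`. -/
def spinRep (Γ : DiracMatrices r s) : Spin r s →* GL (Fin (dγ r s)) ℂ :=
  (Units.map (Γ.cliffordRep : Cl r s →* _)).comp (Spin r s).subtype

/-- `U(1)` acting on `ℂ^d_γ` by scalars. -/
def circleRep (n : ℕ) : Circle →* GL (Fin n) ℂ :=
  (Units.map (algebraMap ℂ (Matrix (Fin n) (Fin n) ℂ) : ℂ →* _)).comp Circle.toUnits

lemma circleRep_val (n : ℕ) (u : Circle) :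
    (circleRep n u : Matrix (Fin n) (Fin n) ℂ) = algebraMap ℂ _ (u : ℂ) := rfl

lemma spinRep_val (Γ : DiracMatrices r s) (g : Spin r s) :
    (Γ.spinRep g : Matrix (Fin (dγ r s)) (Fin (dγ r s)) ℂ) = Γ.cliffordRep (g : (Cl r s)ˣ) := rfl

/-- The representation `[(g, u)] ↦ u ρ(g)` of `Spin^c(r, s)`. -/
def spinCRep (Γ : DiracMatrices r s) : SpinC r s →* GL (Fin (dγ r s)) ℂ :=
  QuotientGroup.lift (spinCKernel r s)
    { toFun := fun p => circleRep _ p.2 * Γ.spinRep p.1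
      map_one' := by simp
      map_mul' := fun p q => by
        refine Units.ext ?_
        simp only [Prod.fst_mul, Prod.snd_mul, map_mul, Units.val_mul, circleRep_val]
        have := Algebra.commutes (q.2 : ℂ)
          (Γ.spinRep p.1 : Matrix (Fin (dγ r s)) (Fin (dγ r s)) ℂ)
        rw [mul_assoc, mul_assoc, ← mul_assoc (algebraMap ℂ _ (q.2 : ℂ)), this, mul_assoc] }
    (by
      rintro ⟨a, u⟩ h
      refine Units.ext ?_
      change (circleRep (dγ r s) u : Matrix (Fin (dγ r s)) (Fin (dγ r s)) ℂ)
        * (Γ.spinRep a : Matrix (Fin (dγ r s)) (Fin (dγ r s)) ℂ) = 1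
      rw [circleRep_val, spinRep_val]
      rcases h with ⟨h₁, h₂⟩ | ⟨h₁, h₂⟩
      · simp only at h₁ h₂
        rw [h₁, h₂]; simp
      · simp only at h₁ h₂
        rw [h₁, h₂]; simp)

lemma spinCRep_mk (Γ : DiracMatrices r s) (g : Spin r s) (u : Circle) :
    (Γ.spinCRep (SpinC.mk r s (g, u)) : Matrix (Fin (dγ r s)) (Fin (dγ r s)) ℂ)
      = (u : ℂ) • Γ.cliffordRep (g : (Cl r s)ˣ) := by
  rw [Algebra.smul_def]; rfl

end DiracMatrices

end Flat

/-! ## Principal bundles, complex vector bundles, associated bundles -/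

section Bundles

/-- A smooth principal `G`-bundle over `M`: a family of fibres with a free and transitive right
action of `G`, together with a bundle atlas of local sections whose `G`-valued transition
functions are smooth. `Smooth f U` says what it means for a map `f : M → G` to be smooth on `U`.
A local section is extended in an arbitrary way outside its open domain. -/
structure PrincipalBundle (M : Type u) [TopologicalSpace M] (G : Type v) [Group G]
    (Smooth : (M → G) → Set M → Prop) where
  /-- the fibre over a point -/
  Fiber : M → Type w
  /-- the right action of the structure group -/
  act : ∀ {x : M}, Fiber x → G → Fiber x
  act_one : ∀ {x : M} (p : Fiber x), act p 1 = p
  act_mul : ∀ {x : M} (p : Fiber x) (g h : G), act p (g * h) = act (act p g) h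
  free : ∀ {x : M} (p : Fiber x) (g : G), act p g = p → g = 1
  transitive : ∀ {x : M} (p q : Fiber x), ∃ g, q = act p g
  /-- the index set of the bundle atlas -/
  Idx : Type w'
  /-- the domain of a local section of the atlas -/
  dom : Idx → Set M
  isOpen_dom : ∀ i, IsOpen (dom i)
  /-- the local sections of the atlas -/
  sec : Idx → ∀ x : M, Fiber x
  cover : ∀ x, ∃ i, x ∈ dom i
  transition : ∀ i j, ∃ g : M → G, Smooth g (dom i ∩ dom j) ∧
    ∀ x ∈ dom i ∩ dom j, sec j x = act (sec i x) (g x)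

variable {n : ℕ}

/-- A smooth complex vector bundle of rank `k` over an `n`-dimensional smooth manifold `M`:
a family of complex vector spaces with an atlas of local frames, whose transition functions
have smooth matrix entries. A local frame is extended in an arbitrary way outside its domain. -/
structure CVectorBundle (M : Type u) [TopologicalSpace M]
    [ChartedSpace (EuclideanSpace ℝ (Fin n)) M] (k : ℕ) where
  /-- the fibre over a point -/
  Fiber : M → Type w
  [addCommGroup : ∀ x, AddCommGroup (Fiber x)]
  [module : ∀ x, Module ℂ (Fiber x)]
  /-- the index set of the bundle atlas -/
  Idx : Type w'
  /-- the domain of a local frame of the atlas -/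
  dom : Idx → Set M
  isOpen_dom : ∀ i, IsOpen (dom i)
  /-- the local frames of the atlas -/
  frame : Idx → ∀ x : M, (Fin k → ℂ) ≃ₗ[ℂ] Fiber x
  cover : ∀ x, ∃ i, x ∈ dom i
  transition : ∀ i j (a b : Fin k), ContMDiffOn (𝓡 n) 𝓘(ℝ, ℂ) ∞
    (fun x => (frame j x).symm (frame i x (Pi.single b 1)) a) (dom i ∩ dom j)

attribute [instance] CVectorBundle.addCommGroup CVectorBundle.module

namespace PrincipalBundle

variable {M : Type u} [TopologicalSpace M] {G : Type v} [Group G]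
  {Smooth : (M → G) → Set M → Prop} {k : ℕ}

/-- The relation `(p, v) ∼ (p g, g⁻¹ v)` on `P_x × ℂ^k`. -/
def assocSetoid (P : PrincipalBundle.{u, v, w, w'} M G Smooth) (ρ : G →* GL (Fin k) ℂ) (x : M) :
    Setoid (P.Fiber x × (Fin k → ℂ)) where
  r p q := ∃ g : G, q = (P.act p.1 g, (ρ g⁻¹ : Matrix (Fin k) (Fin k) ℂ) *ᵥ p.2)
  iseqv :=
    { refl := fun p => ⟨1, by simp [P.act_one]⟩
      symm := by
        rintro ⟨p, v⟩ _ ⟨g, rfl⟩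
        refine ⟨g⁻¹, ?_⟩
        simp only [← P.act_mul, mul_inv_cancel, P.act_one, Matrix.mulVec_mulVec, ← Units.val_mul,
          ← map_mul, inv_inv, map_one, Units.val_one, Matrix.one_mulVec]
      trans := by
        rintro ⟨p, v⟩ _ _ ⟨g, rfl⟩ ⟨h, rfl⟩
        refine ⟨g * h, ?_⟩
        simp only [← P.act_mul, Matrix.mulVec_mulVec, ← Units.val_mul, ← map_mul, mul_inv_rev] }

/-- The fibre `(P_x × ℂ^k) / ∼` of the associated bundle. -/
def AssocFiber (P : PrincipalBundle.{u, v, w, w'} M G Smooth) (ρ : G →* GL (Fin k) ℂ) (x : M) :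
    Type w :=
  Quotient (P.assocSetoid ρ x)

variable (P : PrincipalBundle.{u, v, w, w'} M G Smooth) (ρ : G →* GL (Fin k) ℂ)

/-- The class `[p, v]` in the associated bundle. -/
def assocMk {x : M} (p : P.Fiber x) (v : Fin k → ℂ) : P.AssocFiber ρ x :=
  Quotient.mk (P.assocSetoid ρ x) (p, v)

lemma assocMk_act {x : M} (p : P.Fiber x) (g : G) (v : Fin k → ℂ) :
    P.assocMk ρ (P.act p g) v = P.assocMk ρ p ((ρ g : Matrix (Fin k) (Fin k) ℂ) *ᵥ v) := by
  refine (Quotient.sound (s := P.assocSetoid ρ x) ⟨g, ?_⟩).symm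
  simp only [Matrix.mulVec_mulVec, ← Units.val_mul, ← map_mul, inv_mul_cancel, map_one,
    Units.val_one, Matrix.one_mulVec]

lemma assocMk_bijective {x : M} (p : P.Fiber x) : Function.Bijective (P.assocMk ρ p) := by
  constructor
  · intro v w h
    obtain ⟨g, hg⟩ := Quotient.exact h
    have h1 : P.act p g = p := (congrArg Prod.fst hg).symm
    have h2 : g = 1 := P.free p g h1
    subst h2
    simpa using (congrArg Prod.snd hg).symm
  · intro e
    induction e using Quotient.inductionOn with
    | h q =>
      obtain ⟨q, w⟩ := q
      obtain ⟨g, rfl⟩ := P.transitive p q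
      exact ⟨_, (P.assocMk_act ρ p g w).symm⟩

/-- The bijection `v ↦ [p, v]` from `ℂ^k` to the fibre. -/
def assocEquiv {x : M} (p : P.Fiber x) : (Fin k → ℂ) ≃ P.AssocFiber ρ x :=
  Equiv.ofBijective _ (P.assocMk_bijective ρ p)

/-- Some point of the fibre; the vector space structure below does not depend on it, see
`assocMk_add` and `assocMk_smul`. -/
def somePoint (x : M) : P.Fiber x := P.sec (P.cover x).choose x

instance assocAddCommGroup (x : M) : AddCommGroup (P.AssocFiber ρ x) :=
  (P.assocEquiv ρ (P.somePoint x)).symm.addCommGroup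

instance assocModule (x : M) : Module ℂ (P.AssocFiber ρ x) :=
  (P.assocEquiv ρ (P.somePoint x)).symm.module ℂ

lemma assocMk_some_add {x : M} (v w : Fin k → ℂ) :
    P.assocMk ρ (P.somePoint x) (v + w)
      = P.assocMk ρ (P.somePoint x) v + P.assocMk ρ (P.somePoint x) w :=
  ((P.assocEquiv ρ (P.somePoint x)).symm.linearEquiv ℂ).symm.map_add v w

lemma assocMk_some_smul {x : M} (c : ℂ) (v : Fin k → ℂ) :
    P.assocMk ρ (P.somePoint x) (c • v) = c • P.assocMk ρ (P.somePoint x) v :=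
  ((P.assocEquiv ρ (P.somePoint x)).symm.linearEquiv ℂ).symm.map_smul c v

lemma assocMk_add {x : M} (p : P.Fiber x) (v w : Fin k → ℂ) :
    P.assocMk ρ p (v + w) = P.assocMk ρ p v + P.assocMk ρ p w := by
  obtain ⟨g, rfl⟩ := P.transitive (P.somePoint x) p
  simp only [assocMk_act, Matrix.mulVec_add, assocMk_some_add]

lemma assocMk_smul {x : M} (p : P.Fiber x) (c : ℂ) (v : Fin k → ℂ) :
    P.assocMk ρ p (c • v) = c • P.assocMk ρ p v := by
  obtain ⟨g, rfl⟩ := P.transitive (P.somePoint x) p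
  simp only [assocMk_act, Matrix.mulVec_smul, assocMk_some_smul]

/-- The linear isomorphism `v ↦ [p, v]` from `ℂ^k` to the fibre. -/
def assocFrame {x : M} (p : P.Fiber x) : (Fin k → ℂ) ≃ₗ[ℂ] P.AssocFiber ρ x :=
  { P.assocEquiv ρ p with
    map_add' := P.assocMk_add ρ p
    map_smul' := P.assocMk_smul ρ p }

lemma assocFrame_apply {x : M} (p : P.Fiber x) (v : Fin k → ℂ) :
    P.assocFrame ρ p v = P.assocMk ρ p v := rfl

/-- The associated complex vector bundle `P ×_G ℂ^k` of a smooth representation `ρ`, with the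
local frames `v ↦ [χ(x), v]` given by the local sections `χ` of the atlas of `P`. -/
def associated [ChartedSpace (EuclideanSpace ℝ (Fin n)) M]
    (hρ : ∀ (f : M → G) (U : Set M), Smooth f U → ∀ a b, ContMDiffOn (𝓡 n) 𝓘(ℝ, ℂ) ∞
      (fun x => (ρ (f x) : Matrix (Fin k) (Fin k) ℂ) a b) U) :
    CVectorBundle.{u, w, w'} (n := n) M k where
  Fiber := P.AssocFiber ρ
  Idx := P.Idx
  dom := P.dom
  isOpen_dom := P.isOpen_dom
  frame i x := P.assocFrame ρ (P.sec i x)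
  cover := P.cover
  transition i j a b := by
    obtain ⟨g, hg, h⟩ := P.transition j i
    rw [Set.inter_comm]
    refine (hρ g _ hg a b).congr fun x hx => ?_
    rw [h x hx, assocFrame_apply, assocMk_act, ← assocFrame_apply, LinearEquiv.symm_apply_apply]
    simp

end PrincipalBundle

end Bundles

/-! ## Pseudo-Riemannian geometry -/

section Geometry

/-- A smooth pseudo-Riemannian metric of signature `(r, s)` on an `(r+s)`-dimensional manifold. -/
structure PseudoRiemannianMetric (r s : ℕ) (M : Type u) [TopologicalSpace M]
    [ChartedSpace (EuclideanSpace ℝ (Fin (r + s))) M] [IsManifold (𝓡 (r + s)) ∞ M] where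
  /-- the scalar product on the tangent spaces -/
  inner (x : M) : TangentSpace (𝓡 (r + s)) x →L[ℝ] TangentSpace (𝓡 (r + s)) x →L[ℝ] ℝ
  symm (x : M) (v w : TangentSpace (𝓡 (r + s)) x) : inner x v w = inner x w v
  signature (x : M) : ∃ b : Module.Basis (Fin (r + s)) ℝ (TangentSpace (𝓡 (r + s)) x),
    ∀ a c, inner x (b a) (b c) = eta r s a c
  contMDiff : ContMDiff (𝓡 (r + s)) ((𝓡 (r + s)).prod 𝓘(ℝ, EuclideanSpace ℝ (Fin (r + s)) →L[ℝ]
      EuclideanSpace ℝ (Fin (r + s)) →L[ℝ] ℝ)) ∞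
    (fun x ↦ Bundle.TotalSpace.mk' (EuclideanSpace ℝ (Fin (r + s)) →L[ℝ]
      EuclideanSpace ℝ (Fin (r + s)) →L[ℝ] ℝ)
      (E := fun x : M ↦ TangentSpace (𝓡 (r + s)) x →L[ℝ] TangentSpace (𝓡 (r + s)) x →L[ℝ] ℝ)
      x (inner x))

/-- An orientation of an `n`-dimensional manifold: an orientation of every tangent space such that
around every point there is a smooth positively oriented local frame. -/
structure ManifoldOrientation (n : ℕ) (M : Type u) [TopologicalSpace M]
    [ChartedSpace (EuclideanSpace ℝ (Fin n)) M] [IsManifold (𝓡 n) ∞ M] where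
  /-- the orientation of a tangent space -/
  orient (x : M) : Orientation ℝ (TangentSpace (𝓡 n) x) (Fin n)
  locally_frame (x : M) : ∃ U : Set M, IsOpen U ∧ x ∈ U ∧
    ∃ e : Fin n → ∀ y : M, TangentSpace (𝓡 n) y,
      ∃ he : IsLocalFrameOn (𝓡 n) (EuclideanSpace ℝ (Fin n)) ∞ e U,
        ∀ y (hy : y ∈ U), (he.toBasisAt hy).orientation = orient y

variable {r s : ℕ} {M : Type u} [TopologicalSpace M]
  [ChartedSpace (EuclideanSpace ℝ (Fin (r + s))) M]

/-- `X` is a smooth vector field on `U`. -/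
def IsSmoothVectorField [IsManifold (𝓡 (r + s)) ∞ M] (X : ∀ x : M, TangentSpace (𝓡 (r + s)) x) (U : Set M) : Prop :=
  ContMDiffOn (𝓡 (r + s)) (𝓡 (r + s)).tangent ∞
    (fun x => (⟨x, X x⟩ : TangentBundle (𝓡 (r + s)) M)) U

/-- A map to `Spin(r, s)` is smooth if it is smooth as a map to the (finite-dimensional) Clifford
algebra. -/
def SmoothToSpin (f : M → Spin r s) (U : Set M) : Prop :=
  ∀ l : Cl r s →ₗ[ℝ] ℝ, ContMDiffOn (𝓡 (r + s)) 𝓘(ℝ, ℝ) ∞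
    (fun x => l ((f x : (Cl r s)ˣ) : Cl r s)) U

/-- Smooth maps to `U(1)`. -/
def SmoothToCircle (r s : ℕ) {M : Type u} [TopologicalSpace M]
    [ChartedSpace (EuclideanSpace ℝ (Fin (r + s))) M] (f : M → Circle) (U : Set M) : Prop :=
  ContMDiffOn (𝓡 (r + s)) (𝓡 1) ∞ f U

/-- A map to `Spin^c(r, s)` is smooth if it locally lifts to a smooth map to the two-fold
covering group `Spin(r, s) × U(1)`. -/
def SmoothToSpinC (f : M → SpinC r s) (U : Set M) : Prop :=
  ∀ x ∈ U, ∃ W : Set M, IsOpen W ∧ x ∈ W ∧ ∃ (h : M → Spin r s) (u : M → Circle),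
    SmoothToSpin h (U ∩ W) ∧ SmoothToCircle r s u (U ∩ W) ∧
      ∀ y ∈ U ∩ W, f y = SpinC.mk r s (h y, u y)

lemma smooth_cliffordRep (Γ : DiracMatrices r s) (f : M → Spin r s) (U : Set M)
    (hf : SmoothToSpin f U) (a b : Fin (dγ r s)) :
    ContMDiffOn (𝓡 (r + s)) 𝓘(ℝ, ℂ) ∞
      (fun x => Γ.cliffordRep ((f x : (Cl r s)ˣ) : Cl r s) a b) U := by
  let entry : Cl r s →ₗ[ℝ] ℂ :=
    (Matrix.entryLinearMap ℝ ℂ a b).comp Γ.cliffordRep.toLinearMap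
  have h1 := hf (Complex.reLm.comp entry)
  have h2 := hf (Complex.imLm.comp entry)
  have h3 : ContMDiffOn (𝓡 (r + s)) 𝓘(ℝ, ℝ × ℝ) ∞ (fun x =>
    ((Complex.reLm.comp entry) ((f x : (Cl r s)ˣ) : Cl r s),
      (Complex.imLm.comp entry) ((f x : (Cl r s)ˣ) : Cl r s))) U := h1.prodMk_space h2
  exact Complex.equivRealProdCLM.symm.contDiff.contMDiff.comp_contMDiffOn h3

lemma smooth_spinRep (Γ : DiracMatrices r s) (f : M → Spin r s) (U : Set M)
    (hf : SmoothToSpin f U) (a b : Fin (dγ r s)) :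
    ContMDiffOn (𝓡 (r + s)) 𝓘(ℝ, ℂ) ∞
      (fun x => (Γ.spinRep (f x) : Matrix (Fin (dγ r s)) (Fin (dγ r s)) ℂ) a b) U :=
  smooth_cliffordRep Γ f U hf a b

lemma smooth_spinCRep (Γ : DiracMatrices r s) (f : M → SpinC r s) (U : Set M)
    (hf : SmoothToSpinC f U) (a b : Fin (dγ r s)) :
    ContMDiffOn (𝓡 (r + s)) 𝓘(ℝ, ℂ) ∞
      (fun x => (Γ.spinCRep (f x) : Matrix (Fin (dγ r s)) (Fin (dγ r s)) ℂ) a b) U := by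
  refine contMDiffOn_of_locally_contMDiffOn fun x hx => ?_
  obtain ⟨W, hW, hxW, h, u, hh, hu, hfe⟩ := hf x hx
  refine ⟨W, hW, hxW, ?_⟩
  have hu' : ContMDiffOn (𝓡 (r + s)) 𝓘(ℝ, ℂ) ∞ (fun y => (u y : ℂ)) (U ∩ W) := by
    have : Fact (Module.finrank ℝ ℂ = 1 + 1) := finrank_real_complex_fact'
    exact (contMDiff_coe_sphere (E := ℂ) (n := 1) (m := ∞)).comp_contMDiffOn hu
  have hm : ContDiff ℝ ∞ (fun z : ℂ × ℂ => z.1 * z.2) := contDiff_mul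
  refine (hm.contMDiff.comp_contMDiffOn
    (hu'.prodMk_space (smooth_cliffordRep Γ h _ hh a b))).congr fun y hy => ?_
  rw [hfe y hy, DiracMatrices.spinCRep_mk]
  rfl

/-! ## Spin structures, Spin^c structures, Dirac structures -/

variable [IsManifold (𝓡 (r + s)) ∞ M]

/-- The fibre of `SO(M)` over `x`: the oriented pseudo-orthonormal frames of the tangent space. -/
structure SOFrame (g : PseudoRiemannianMetric r s M) (o : ManifoldOrientation (r + s) M)
    (x : M) where
  /-- the vectors of the frame -/
  basis : Module.Basis (Fin (r + s)) ℝ (TangentSpace (𝓡 (r + s)) x)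
  orthonormal : ∀ a b, g.inner x (basis a) (basis b) = eta r s a b
  oriented : basis.orientation = o.orient x

variable {g : PseudoRiemannianMetric r s M} {o : ManifoldOrientation (r + s) M}

/-- A frame as the linear isomorphism from `ℝ^(r+s)` to the tangent space that maps the standard
basis to the frame. In these terms the right action of `Λ` on frames is `e ↦ e ∘ Λ`. -/
def SOFrame.toEquiv {x : M} (e : SOFrame g o x) :
    (Fin (r + s) → ℝ) ≃ₗ[ℝ] TangentSpace (𝓡 (r + s)) x :=
  e.basis.equivFun.symm

/-- A spin structure on `(M, g)`: a principal `Spin(r, s)`-bundle with a smooth bundle map `Φ`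
to `SO(M)` over `M` such that `Φ (p h) = Φ (p) Π(h)`. -/
structure SpinStructure (g : PseudoRiemannianMetric r s M) (o : ManifoldOrientation (r + s) M) where
  /-- the bundle of spin frames -/
  bundle : PrincipalBundle.{u, 0, w, w'} M (Spin r s) SmoothToSpin
  /-- the bundle map to `SO(M)` -/
  Φ : ∀ {x : M}, bundle.Fiber x → SOFrame g o x
  equivariant : ∀ {x : M} (p : bundle.Fiber x) (h : Spin r s) (v : Fin (r + s) → ℝ),
    (Φ (bundle.act p h)).toEquiv v = (Φ p).toEquiv (spinCover r s h v)
  smooth : ∀ (i : bundle.Idx) (a : Fin (r + s)),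
    IsSmoothVectorField (fun x => (Φ (bundle.sec i x)).basis a) (bundle.dom i)

/-- A Spin^c structure on `(M, g)`: a principal `U(1)`-bundle `L`, a principal
`Spin^c(r, s)`-bundle and a smooth bundle map `(Φ, Ψ)` to `SO(M) × L` over `M`, equivariant for
`[(g, u)] ↦ (Π(g), u²)`. -/
structure SpinCStructure (g : PseudoRiemannianMetric r s M)
    (o : ManifoldOrientation (r + s) M) where
  /-- the `U(1)`-bundle -/
  lineBundle : PrincipalBundle.{u, 0, w, w'} M Circle (SmoothToCircle r s)
  /-- the bundle of Spin^c frames -/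
  bundle : PrincipalBundle.{u, 0, w, w'} M (SpinC r s) SmoothToSpinC
  /-- the first component of the bundle map, to `SO(M)` -/
  Φ : ∀ {x : M}, bundle.Fiber x → SOFrame g o x
  /-- the second component of the bundle map, to the `U(1)`-bundle -/
  Ψ : ∀ {x : M}, bundle.Fiber x → lineBundle.Fiber x
  equivariant : ∀ {x : M} (p : bundle.Fiber x) (h : SpinC r s) (v : Fin (r + s) → ℝ),
    (Φ (bundle.act p h)).toEquiv v = (Φ p).toEquiv (spinCCover r s h v)
  equivariant_line : ∀ {x : M} (p : bundle.Fiber x) (h : SpinC r s),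
    Ψ (bundle.act p h) = lineBundle.act (Ψ p) (spinCSq r s h)
  smooth : ∀ (i : bundle.Idx) (a : Fin (r + s)),
    IsSmoothVectorField (fun x => (Φ (bundle.sec i x)).basis a) (bundle.dom i)
  smooth_line : ∀ (i : bundle.Idx) (j : lineBundle.Idx), ∃ t : M → Circle,
    SmoothToCircle r s t (bundle.dom i ∩ lineBundle.dom j) ∧
      ∀ x ∈ bundle.dom i ∩ lineBundle.dom j,
        Ψ (bundle.sec i x) = lineBundle.act (lineBundle.sec j x) (t x)

/-- The spinor bundle `Spin(M) ×_Spin(r,s) ℂ^d_γ`, formed with the representation given by a set of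
Dirac matrices. -/
def SpinStructure.spinorBundle (σ : SpinStructure.{u, w, w'} g o) (Γ : DiracMatrices r s) :
    CVectorBundle.{u, w, w'} (n := r + s) M (dγ r s) :=
  σ.bundle.associated Γ.spinRep (smooth_spinRep Γ)

/-- The spinor bundle of a Spin^c structure. -/
def SpinCStructure.spinorBundle (σ : SpinCStructure.{u, w, w'} g o) (Γ : DiracMatrices r s) :
    CVectorBundle.{u, w, w'} (n := r + s) M (dγ r s) :=
  σ.bundle.associated Γ.spinCRep (smooth_spinCRep Γ)

/-- The element `[p, v]` of the spinor bundle given by a spin frame `p` and components `v`; as a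
linear isomorphism in `v`. -/
def SpinStructure.spinor (σ : SpinStructure.{u, w, w'} g o) (Γ : DiracMatrices r s) {x : M}
    (p : σ.bundle.Fiber x) : (Fin (dγ r s) → ℂ) ≃ₗ[ℂ] (σ.spinorBundle Γ).Fiber x :=
  σ.bundle.assocFrame Γ.spinRep p

/-- The element `[p, v]` of the spinor bundle given by a Spin^c frame `p` and components `v`; as a
linear isomorphism in `v`. -/
def SpinCStructure.spinor (σ : SpinCStructure.{u, w, w'} g o) (Γ : DiracMatrices r s) {x : M}
    (p : σ.bundle.Fiber x) : (Fin (dγ r s) → ℂ) ≃ₗ[ℂ] (σ.spinorBundle Γ).Fiber x :=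
  σ.bundle.assocFrame Γ.spinCRep p

/-- A (not necessarily smooth) section of `T^*M ⊗ End(E)`: at each point a real-linear map from the
tangent space to the complex-linear endomorphisms of the fibre. -/
abbrev EndValuedForm (r s : ℕ) {M : Type u} [TopologicalSpace M]
    [ChartedSpace (EuclideanSpace ℝ (Fin (r + s))) M] {k : ℕ}
    (E : CVectorBundle.{u, w, w'} (n := r + s) M k) : Type (max u w) :=
  ∀ x : M, TangentSpace (𝓡 (r + s)) x →ₗ[ℝ] Module.End ℂ (E.Fiber x)

/-- `γ` is a Dirac structure on `E`: a smooth section of `T^*M ⊗ End(E)` with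
`{γ(X), γ(Y)} = -2 g(X, Y) 1`. Smoothness: in the local frames of `E`, the matrix entries of `γ(X)`
are smooth for every smooth local vector field `X`. -/
structure IsDiracStructure (g : PseudoRiemannianMetric r s M)
    (E : CVectorBundle.{u, w, w'} (n := r + s) M (dγ r s)) (γ : EndValuedForm r s E) : Prop where
  smooth : ∀ (i : E.Idx) (W : Set M), IsOpen W → W ⊆ E.dom i →
    ∀ X : (∀ x : M, TangentSpace (𝓡 (r + s)) x), IsSmoothVectorField X W →
      ∀ a b, ContMDiffOn (𝓡 (r + s)) 𝓘(ℝ, ℂ) ∞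
        (fun x => (E.frame i x).symm (γ x (X x) (E.frame i x (Pi.single b 1))) a) W
  clifford : ∀ (x : M) (X Y : TangentSpace (𝓡 (r + s)) x),
    γ x X * γ x Y + γ x Y * γ x X = ((-2 * g.inner x X Y : ℝ) : ℂ) • 1

/-- In every spin frame `p` the section `γ` is given by the constant matrices `Δ_a`:
`γ(e_a) [p, v] = [p, Δ_a v]`, where `e_a` is the orthonormal frame `Φ(p)`. -/
def SpinStructure.HasConstantMatrices (σ : SpinStructure.{u, w, w'} g o) {Γ : DiracMatrices r s}
    (γ : EndValuedForm r s (σ.spinorBundle Γ))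
    (Δ : Fin (r + s) → Matrix (Fin (dγ r s)) (Fin (dγ r s)) ℂ) : Prop :=
  ∀ (x : M) (p : σ.bundle.Fiber x) (a : Fin (r + s)) (v : Fin (dγ r s) → ℂ),
    γ x ((σ.Φ p).basis a) (σ.spinor Γ p v) = σ.spinor Γ p (Δ a *ᵥ v)

/-- In every Spin^c frame `p` the section `γ` is given by the constant matrices `Δ_a`. -/
def SpinCStructure.HasConstantMatrices (σ : SpinCStructure.{u, w, w'} g o) {Γ : DiracMatrices r s}
    (γ : EndValuedForm r s (σ.spinorBundle Γ))
    (Δ : Fin (r + s) → Matrix (Fin (dγ r s)) (Fin (dγ r s)) ℂ) : Prop :=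
  ∀ (x : M) (p : σ.bundle.Fiber x) (a : Fin (r + s)) (v : Fin (dγ r s) → ℂ),
    γ x ((σ.Φ p).basis a) (σ.spinor Γ p v) = σ.spinor Γ p (Δ a *ᵥ v)

end Geometry

end

/-!
The proof has an algebraic part, about Clifford systems (pairwise anticommuting endomorphisms with
prescribed non-zero scalar squares) on a complex vector space `V` of dimension `2 ^ ⌊D / 2⌋`, and a
geometric part, which only transports constant matrices along spinor frames.

*Algebra.* Let `μ² = - c 0 * c 1`. The product `γ 0 * γ 1` has the eigenvalues `± μ`, its
`μ`-eigenspace `W` is stable under the other `γ a`, and `γ 0` exchanges the two eigenspaces, so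
`V = W ⊕ γ 0 W`, and the whole system is determined by the system of `D - 2` endomorphisms on `W`
(`IsCliffordSystem.split_double`). Induction on `D` in steps of two gives existence
(`exists_of_squares`), Pauli's theorem that two systems are isomorphic up to a sign, which is `1` for
even `D` (`exists_intertwiner`), Schur's lemma (`exists_eq_smul_of_commute`), and for odd `D` the
fact that no automorphism takes the system to its negative (`eq_zero_of_anticommute`).

*Rigidity.* If a section of `T^*M ⊗ End(E_Γ)` is given by constant matrices `Δ` in all spinor frames,
comparing the frames `p` and `p h` shows that `Δ` is equivariant for the representation `ρ_Γ`
defined by `Γ`. By Schur's lemma `ρ_Γ(h)` is then a scalar multiple of `ρ_Δ(h)`. Evaluating at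
`h = e_a e_b` and at `h = e_a w` with a unit vector `w` in the plane of `e_a` and `e_b` shows that the
scalars are `1`, that is `Γ a * Γ b = Δ a * Δ b`
(`DiracMatrices.mul_eq_mul_of_equivariant`). Given natural sections with constant matrices `Δ` and
`Δ'`, Pauli's theorem yields `S` with `Δ' a = ± S (Δ a) S⁻¹`. The sign cancels in products of two
matrices, so `S` intertwines `ρ_Γ` and `ρ_Γ'`, and `[p, v] ↦ [p, S v]` is well defined.

*Geometry.* Existence holds since `Γ` itself is equivariant for `ρ_Γ`. The Dirac structure is smooth
since the components of a vector field in a smooth orthonormal frame are scalar products. Spin and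
`Spin^c` structures are treated together (`SpinorFrames`), as `Spin^c` acts on spinors by scalar
multiples of the action of `Spin`.
-/

noncomputable section

/-! ### Clifford systems on complex vector spaces -/

/-- Endomorphisms `γ a` of a complex vector space that anticommute pairwise and whose squares are
the scalars `c a`. -/
structure IsCliffordSystem {D : ℕ} {V : Type*} [AddCommGroup V] [Module ℂ V]
    (c : Fin D → ℂ) (γ : Fin D → Module.End ℂ V) : Prop where
  sq : ∀ a v, γ a (γ a v) = c a • v
  anticomm : ∀ a b, a ≠ b → ∀ v, γ a (γ b v) = -γ b (γ a v)

namespace IsCliffordSystem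

section Split

variable {D : ℕ} {V : Type*} [AddCommGroup V] [Module ℂ V] {c : Fin (D + 2) → ℂ}
  {γ : Fin (D + 2) → Module.End ℂ V}

/-- The `μ`-eigenspace of `γ 0 * γ 1`. For `μ² = - c 0 * c 1` this is one half of `V`, stable under
the remaining `γ a`. -/
def half (γ : Fin (D + 2) → Module.End ℂ V) (μ : ℂ) : Submodule ℂ V :=
  Module.End.eigenspace (γ 0 * γ 1) μ

lemma mem_half {μ : ℂ} {v : V} : v ∈ half γ μ ↔ γ 0 (γ 1 v) = μ • v :=
  Module.End.mem_eigenspace_iff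

lemma succ_succ_mem_half (h : IsCliffordSystem c γ) {μ : ℂ} (a : Fin D) {v : V}
    (hv : v ∈ half γ μ) : γ a.succ.succ v ∈ half γ μ := by
  rw [mem_half] at hv ⊢
  rw [h.anticomm 1 _ (by simp [Fin.ext_iff]), map_neg,
    h.anticomm 0 _ (by simp [Fin.ext_iff]), neg_neg, hv, map_smul]

/-- The action of the remaining `γ a` on the eigenspace `half γ μ`. -/
def halfSystem (h : IsCliffordSystem c γ) (μ : ℂ) (a : Fin D) : Module.End ℂ (half γ μ) :=
  (γ a.succ.succ).restrict fun _ hv => h.succ_succ_mem_half a hv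

lemma coe_halfSystem (h : IsCliffordSystem c γ) (μ : ℂ) (a : Fin D) (x : half γ μ) :
    (h.halfSystem μ a x : V) = γ a.succ.succ x := rfl

lemma isCliffordSystem_halfSystem (h : IsCliffordSystem c γ) (μ : ℂ) :
    IsCliffordSystem (fun a => c a.succ.succ) (h.halfSystem μ) where
  sq a v := Subtype.ext (h.sq _ _)
  anticomm a b hab v := Subtype.ext (h.anticomm _ _ (by simpa using hab) _)

/-- The map `(x, y) ↦ x + γ 0 y`, for `x` and `y` in the eigenspace `half γ μ`. -/
def splitMap (γ : Fin (D + 2) → Module.End ℂ V) (μ : ℂ) : (half γ μ × half γ μ) →ₗ[ℂ] V :=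
  (half γ μ).subtype.coprod (γ 0 ∘ₗ (half γ μ).subtype)

lemma apply_zero_apply_one_apply_zero (h : IsCliffordSystem c γ) {μ : ℂ} (y : half γ μ) :
    γ 0 (γ 1 (γ 0 (y : V))) = -(μ • γ 0 (y : V)) := by
  rw [h.anticomm 1 0 (by simp), mem_half.1 y.2, map_neg, map_smul]

/-- `γ 0` maps the `μ`-eigenspace of `γ 0 * γ 1` onto the `-μ`-eigenspace, and `V` is the direct sum
of the two. -/
lemma splitMap_bijective (h : IsCliffordSystem c γ) {μ : ℂ} (hμ : μ * μ = -(c 0 * c 1))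
    (hc : ∀ a, c a ≠ 0) : Function.Bijective (splitMap γ μ) := by
  have hμ0 : μ ≠ 0 := by
    rintro rfl
    exact mul_ne_zero (hc 0) (hc 1) (by simpa using hμ.symm)
  have hq : ∀ v, γ 0 (γ 1 (γ 0 (γ 1 v))) = (μ * μ) • v := fun v => by
    rw [h.anticomm 1 0 (by simp), map_neg, h.sq, h.sq, hμ, neg_smul, mul_smul]
  constructor
  · rw [← LinearMap.ker_eq_bot, LinearMap.ker_eq_bot']
    rintro ⟨x, y⟩ hxy
    have e1 : (x : V) + γ 0 y = 0 := hxy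
    have e2 := congrArg (fun v => γ 0 (γ 1 v)) e1
    simp only [map_add, map_zero, mem_half.1 x.2, h.apply_zero_apply_one_apply_zero] at e2
    rw [← smul_neg, ← smul_add, smul_eq_zero_iff_right hμ0] at e2
    have e3 : (2 : ℂ) • (x : V) = 0 := by
      rw [two_smul]
      calc (x : V) + x = (x + γ 0 y) + (x + -γ 0 y) := by abel
        _ = 0 := by rw [e1, e2, add_zero]
    have hx : (x : V) = 0 := (smul_eq_zero_iff_right two_ne_zero).1 e3
    rw [hx, zero_add] at e1
    have hy : (y : V) = 0 := by
      have := h.sq 0 (y : V)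
      rw [e1, map_zero] at this
      exact (smul_eq_zero_iff_right (hc 0)).1 this.symm
    exact Prod.ext (Subtype.ext hx) (Subtype.ext hy)
  · intro v
    -- The two components are the projections `(v ± μ⁻¹ γ 0 (γ 1 v)) / 2`.
    have hx : (2 : ℂ)⁻¹ • (v + μ⁻¹ • γ 0 (γ 1 v)) ∈ half γ μ := by
      rw [mem_half]
      simp only [map_smul, map_add, hq]
      rw [smul_smul μ⁻¹, inv_mul_cancel_left₀ hμ0, smul_comm μ, smul_add μ,
        smul_inv_smul₀ hμ0, add_comm]
    have hu : γ 0 (γ 1 (v - μ⁻¹ • γ 0 (γ 1 v))) = -(μ • (v - μ⁻¹ • γ 0 (γ 1 v))) := by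
      simp only [map_smul, map_sub, hq]
      rw [smul_smul μ⁻¹, inv_mul_cancel_left₀ hμ0, smul_sub, smul_inv_smul₀ hμ0, neg_sub]
    have hy : (c 0)⁻¹ • γ 0 ((2 : ℂ)⁻¹ • (v - μ⁻¹ • γ 0 (γ 1 v))) ∈ half γ μ := by
      rw [map_smul]
      refine Submodule.smul_mem _ _ (Submodule.smul_mem _ _ ?_)
      rw [mem_half, h.anticomm 1 0 (by simp), map_neg, hu, map_neg, neg_neg, map_smul]
    refine ⟨(⟨_, hx⟩, ⟨_, hy⟩), ?_⟩
    change (2 : ℂ)⁻¹ • (v + μ⁻¹ • γ 0 (γ 1 v))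
      + γ 0 ((c 0)⁻¹ • γ 0 ((2 : ℂ)⁻¹ • (v - μ⁻¹ • γ 0 (γ 1 v)))) = v
    rw [map_smul, h.sq, inv_smul_smul₀ (hc 0), ← smul_add, add_add_sub_cancel, ← two_smul ℂ v,
      inv_smul_smul₀ two_ne_zero]

/-- The isomorphism `(x, y) ↦ x + γ 0 y` from two copies of `half γ μ` to `V`. -/
def split (h : IsCliffordSystem c γ) {μ : ℂ} (hμ : μ * μ = -(c 0 * c 1)) (hc : ∀ a, c a ≠ 0) :
    (half γ μ × half γ μ) ≃ₗ[ℂ] V :=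
  LinearEquiv.ofBijective (splitMap γ μ) (h.splitMap_bijective hμ hc)

lemma split_apply (h : IsCliffordSystem c γ) {μ : ℂ} (hμ : μ * μ = -(c 0 * c 1))
    (hc : ∀ a, c a ≠ 0) (x y : half γ μ) : h.split hμ hc (x, y) = (x : V) + γ 0 y := rfl

end Split

/-- The Clifford system with two more generators on `W × W` built from a system on `W`. The first
two generators are off-diagonal and have the squares `k` and `-l² / k`. -/
def double {D : ℕ} {W : Type*} [AddCommGroup W] [Module ℂ W] (k l : ℂ)
    (β : Fin D → Module.End ℂ W) : Fin (D + 2) → Module.End ℂ (W × W) :=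
  Fin.cons ((k • LinearMap.snd ℂ W W).prod (LinearMap.fst ℂ W W))
    (Fin.cons ((-l • LinearMap.snd ℂ W W).prod ((l / k) • LinearMap.fst ℂ W W))
      fun a => (β a).prodMap (-β a))

section Double

variable {D : ℕ} {W : Type*} [AddCommGroup W] [Module ℂ W] (k l : ℂ)
    (β : Fin D → Module.End ℂ W) (x y : W)

lemma double_zero : double k l β 0 (x, y) = (k • y, x) := rfl

lemma double_one : double k l β 1 (x, y) = (-l • y, (l / k) • x) := rfl

lemma double_succ_succ (a : Fin D) : double k l β a.succ.succ (x, y) = (β a x, -β a y) := rfl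

end Double

/-- In the splitting of `V` the system has the block form `double`. -/
lemma split_double {D : ℕ} {V : Type*} [AddCommGroup V] [Module ℂ V] {c : Fin (D + 2) → ℂ}
    {γ : Fin (D + 2) → Module.End ℂ V} (h : IsCliffordSystem c γ) {μ : ℂ}
    (hμ : μ * μ = -(c 0 * c 1)) (hc : ∀ a, c a ≠ 0) (a : Fin (D + 2)) (z : half γ μ × half γ μ) :
    h.split hμ hc (double (c 0) μ (h.halfSystem μ) a z) = γ a (h.split hμ hc z) := by
  obtain ⟨x, y⟩ := z
  refine Fin.cases ?_ (fun a => Fin.cases ?_ (fun a => ?_) a) a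
  · rw [double_zero, split_apply, split_apply, map_add, h.sq, add_comm]; rfl
  · change h.split hμ hc (double (c 0) μ (h.halfSystem μ) 1 (x, y)) = γ 1 (h.split hμ hc (x, y))
    rw [double_one, split_apply, split_apply, map_add, h.anticomm 1 0 (by simp),
      mem_half.1 y.2, add_comm]
    have : γ 1 (x : V) = (c 0)⁻¹ • γ 0 (γ 0 (γ 1 (x : V))) := by
      rw [h.sq, inv_smul_smul₀ (hc 0)]
    rw [this, mem_half.1 x.2]
    simp [smul_smul, div_eq_inv_mul]
  · rw [double_succ_succ, split_apply, split_apply, map_add, h.anticomm _ 0 (by simp [Fin.ext_iff])]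
    simp [coe_halfSystem]

lemma isCliffordSystem_double {D : ℕ} {W : Type*} [AddCommGroup W] [Module ℂ W] {k l : ℂ}
    (hk : k ≠ 0) {c : Fin D → ℂ} {β : Fin D → Module.End ℂ W} (h : IsCliffordSystem c β) :
    IsCliffordSystem (Fin.cons k (Fin.cons (-(l * l) / k) c) : Fin (D + 2) → ℂ)
      (double k l β) where
  sq a v := by
    obtain ⟨x, y⟩ := v
    refine Fin.cases ?_ (fun a => Fin.cases ?_ (fun a => ?_) a) a
    · simp [double_zero]
    · change double k l β 1 (double k l β 1 (x, y)) = (-(l * l) / k) • (x, y)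
      simp only [double_one, Prod.smul_mk, smul_smul]
      congr 2 <;> ring
    · simp [double_succ_succ, h.sq]
  anticomm a b hab v := by
    obtain ⟨x, y⟩ := v
    have h01 : double k l β 0 (double k l β 1 (x, y))
        = -double k l β 1 (double k l β 0 (x, y)) := by
      simp only [double_zero, double_one, smul_smul, Prod.neg_mk, neg_smul, neg_neg]
      rw [mul_div_cancel₀ _ hk, div_mul_cancel₀ _ hk]
    have h0 : ∀ a : Fin D, double k l β 0 (double k l β a.succ.succ (x, y))
        = -double k l β a.succ.succ (double k l β 0 (x, y)) := fun a => by
      simp [double_zero, double_succ_succ]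
    have h1 : ∀ a : Fin D, double k l β 1 (double k l β a.succ.succ (x, y))
        = -double k l β a.succ.succ (double k l β 1 (x, y)) := fun a => by
      simp [double_one, double_succ_succ]
    revert hab
    refine Fin.cases ?_ (fun a => Fin.cases ?_ (fun a => ?_) a) a <;>
      refine Fin.cases ?_ (fun b => Fin.cases ?_ (fun b => ?_) b) b <;> intro hab
    · exact absurd rfl hab
    · exact h01
    · exact h0 b
    · exact neg_eq_iff_eq_neg.1 h01.symm
    · exact absurd rfl hab
    · exact h1 b
    · exact neg_eq_iff_eq_neg.1 (h0 a).symm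
    · exact neg_eq_iff_eq_neg.1 (h1 a).symm
    · have hab' : a ≠ b := by rintro rfl; exact hab rfl
      simp [double_succ_succ, h.anticomm a b hab']

lemma exists_mul_self_eq (z : ℂ) : ∃ μ : ℂ, μ * μ = z :=
  (IsAlgClosed.exists_eq_mul_self z).imp fun _ h => h.symm

lemma finrank_half {D : ℕ} {V : Type*} [AddCommGroup V] [Module ℂ V] {c : Fin (D + 2) → ℂ}
    {γ : Fin (D + 2) → Module.End ℂ V} (h : IsCliffordSystem c γ) {μ : ℂ}
    (hμ : μ * μ = -(c 0 * c 1)) (hc : ∀ a, c a ≠ 0)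
    (hV : Module.finrank ℂ V = 2 ^ ((D + 2) / 2)) :
    Module.finrank ℂ (half γ μ) = 2 ^ (D / 2) := by
  have : FiniteDimensional ℂ V := Module.finite_of_finrank_pos (hV ▸ by positivity)
  have e := (h.split hμ hc).finrank_eq
  rw [Module.finrank_prod, hV, Nat.add_div_right _ two_pos, pow_succ] at e
  omega

/-- Clifford systems with any number `D` of generators and any non-zero squares exist on a space of
dimension `2 ^ (D / 2)`. -/
theorem exists_of_squares : ∀ {D : ℕ} (c : Fin D → ℂ), (∀ a, c a ≠ 0) →
    ∃ γ : Fin D → Module.End ℂ (Fin (2 ^ (D / 2)) → ℂ), IsCliffordSystem c γ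
  | 0, _, _ => ⟨0, fun a => a.elim0, fun a => a.elim0⟩
  | 1, c, _ => by
    obtain ⟨μ, hμ⟩ := exists_mul_self_eq (c 0)
    refine ⟨fun _ => μ • 1, fun a v => ?_, fun a b hab => absurd (Subsingleton.elim a b) hab⟩
    rw [Subsingleton.elim a 0, ← hμ]
    simp [smul_smul]
  | D + 2, c, hc => by
    obtain ⟨β, hβ⟩ := exists_of_squares (fun a => c a.succ.succ) fun a => hc _
    obtain ⟨l, hl⟩ := exists_mul_self_eq (-(c 0 * c 1))
    have h := isCliffordSystem_double (l := l) (hc 0) hβ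
    let e : ((Fin (2 ^ (D / 2)) → ℂ) × (Fin (2 ^ (D / 2)) → ℂ)) ≃ₗ[ℂ]
        (Fin (2 ^ ((D + 2) / 2)) → ℂ) :=
      LinearEquiv.ofFinrankEq _ _ (by
        rw [Module.finrank_prod, Module.finrank_fin_fun, Module.finrank_fin_fun,
          Nat.add_div_right _ two_pos, pow_succ, mul_two])
    have hc' : c = Fin.cons (c 0) (Fin.cons (-(l * l) / c 0) fun a => c a.succ.succ) := by
      ext a
      refine Fin.cases rfl (fun a => Fin.cases ?_ (fun a => rfl) a) a
      change c 1 = -(l * l) / c 0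
      rw [hl, neg_neg, mul_div_cancel_left₀ _ (hc 0)]
    refine ⟨fun a => e.conj (double (c 0) l β a), fun a v => ?_, fun a b hab v => ?_⟩
    · rw [hc']
      simpa [LinearEquiv.conj_apply] using congrArg e (h.sq a (e.symm v))
    · simpa [LinearEquiv.conj_apply] using congrArg e (h.anticomm a b hab (e.symm v))

/-- Two Clifford systems with the same squares on spaces of dimension `2 ^ (D / 2)` are isomorphic
up to a common sign, which is needed for odd `D` only. By induction, the isomorphism is built from
one of the eigenspaces `half`. -/
theorem exists_intertwiner : ∀ {D : ℕ} {V V' : Type*} [AddCommGroup V] [Module ℂ V]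
    [AddCommGroup V'] [Module ℂ V'] {c : Fin D → ℂ} {γ : Fin D → Module.End ℂ V}
    {γ' : Fin D → Module.End ℂ V'}, IsCliffordSystem c γ → IsCliffordSystem c γ' →
    (∀ a, c a ≠ 0) → Module.finrank ℂ V = 2 ^ (D / 2) → Module.finrank ℂ V' = 2 ^ (D / 2) →
    ∃ (T : V ≃ₗ[ℂ] V') (ε : ℂ), (ε = 1 ∨ ε = -1) ∧ (Even D → ε = 1) ∧
      ∀ a v, γ' a (T v) = ε • T (γ a v)
  | 0, V, V', _, _, _, _, _, _, _, _, _, _, hV, hV' => by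
    have : FiniteDimensional ℂ V := Module.finite_of_finrank_pos (hV ▸ by positivity)
    have : FiniteDimensional ℂ V' := Module.finite_of_finrank_pos (hV' ▸ by positivity)
    exact ⟨LinearEquiv.ofFinrankEq V V' (hV.trans hV'.symm), 1, Or.inl rfl, fun _ => rfl,
      fun a => a.elim0⟩
  | 1, V, V', _, _, _, _, c, γ, γ', h, h', hc, hV, hV' => by
    have : FiniteDimensional ℂ V := Module.finite_of_finrank_pos (hV ▸ by positivity)
    have : FiniteDimensional ℂ V' := Module.finite_of_finrank_pos (hV' ▸ by positivity)
    obtain ⟨k, hk, -⟩ := LinearMap.existsUnique_eq_smul_id_of_finrank_eq_one hV (γ 0)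
    obtain ⟨k', hk', -⟩ := LinearMap.existsUnique_eq_smul_id_of_finrank_eq_one hV' (γ' 0)
    obtain ⟨v, hv⟩ := Module.finrank_pos_iff_exists_ne_zero.1 (by rw [hV]; norm_num)
    obtain ⟨v', hv'⟩ := Module.finrank_pos_iff_exists_ne_zero.1 (by rw [hV']; norm_num)
    have e : k * k = c 0 := by
      have := h.sq 0 v
      rw [hk] at this
      exact smul_left_injective ℂ hv (by simpa [smul_smul] using this)
    have e' : k' * k' = c 0 := by
      have := h'.sq 0 v'
      rw [hk'] at this
      exact smul_left_injective ℂ hv' (by simpa [smul_smul] using this)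
    let T := LinearEquiv.ofFinrankEq V V' (hV.trans hV'.symm)
    have key : ∃ ε : ℂ, (ε = 1 ∨ ε = -1) ∧ k' = ε * k := by
      rcases mul_self_eq_mul_self_iff.1 (e'.trans e.symm) with hkk | hkk
      · exact ⟨1, Or.inl rfl, by rw [hkk, one_mul]⟩
      · exact ⟨-1, Or.inr rfl, by rw [hkk, neg_one_mul]⟩
    obtain ⟨ε, hε, hkk⟩ := key
    refine ⟨T, ε, hε, fun h1 => absurd h1 (by decide), fun a v => ?_⟩
    rw [Subsingleton.elim a 0, hk, hk', hkk]
    simp [smul_smul]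
  | D + 2, V, V', _, _, _, _, c, γ, γ', h, h', hc, hV, hV' => by
    obtain ⟨μ, hμ⟩ := exists_mul_self_eq (-(c 0 * c 1))
    obtain ⟨T, ε, hε, hD, hT⟩ := exists_intertwiner (h.isCliffordSystem_halfSystem μ)
      (h'.isCliffordSystem_halfSystem μ) (fun a => hc _) (h.finrank_half hμ hc hV)
      (h'.finrank_half hμ hc hV')
    have hεε : ε * ε = 1 := by rcases hε with rfl | rfl <;> norm_num
    have hε0 : ε ≠ 0 := left_ne_zero_of_mul_eq_one hεε
    let Tε : half γ μ ≃ₗ[ℂ] half γ' μ := T.trans (LinearEquiv.smulOfNeZero ℂ _ ε hε0)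
    have hTε : ∀ x, Tε x = ε • T x := fun x => rfl
    -- On `γ 0 (half γ μ)` the relation `γ' 0 T = ε T γ 0` forces `γ 0 y ↦ ε γ' 0 (T y)`.
    refine ⟨((h.split hμ hc).symm.trans (T.prodCongr Tε)).trans (h'.split hμ hc), ε, hε,
      fun h2 => hD (by simpa [Nat.even_add] using h2), fun a v => ?_⟩
    obtain ⟨⟨x, y⟩, rfl⟩ := (h.split hμ hc).surjective v
    rw [← h.split_double]
    simp only [LinearEquiv.trans_apply, LinearEquiv.symm_apply_apply]
    rw [← h'.split_double, ← map_smul]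
    congr 1
    refine Fin.cases ?_ (fun a => Fin.cases ?_ (fun a => ?_) a) a
    · simp [double_zero, hTε, smul_smul, hεε, mul_comm]
    · change double _ _ _ 1 _ = ε • (T.prodCongr Tε) (double _ _ _ 1 (x, y))
      simp [double_one, hTε, smul_smul, mul_comm]
      rw [← mul_assoc, hεε, one_mul]
    · simp [double_succ_succ, hTε, hT]

section Commutant

variable {D : ℕ} {V : Type*} [AddCommGroup V] [Module ℂ V] {c : Fin (D + 2) → ℂ}
  {γ : Fin (D + 2) → Module.End ℂ V}

/-- An endomorphism that commutes or anticommutes with all `γ a` preserves the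
eigenspace `half`. -/
lemma map_mem_half {ε : ℂ} (hε : ε * ε = 1) {X : Module.End ℂ V}
    (hX : ∀ a v, X (γ a v) = ε • γ a (X v)) {μ : ℂ} {v : V} (hv : v ∈ half γ μ) :
    X v ∈ half γ μ := by
  rw [mem_half] at hv ⊢
  rw [← map_smul, ← hv, hX, hX, map_smul, smul_smul, hε, one_smul]

/-- If `X γ a = ε γ a X` for all `a`, where `ε² = 1`, and `X` is the scalar `k` on `half γ μ`, then
`X` is the scalar `ε k` on the complement `γ 0 (half γ μ)`. -/
lemma map_split (h : IsCliffordSystem c γ) {μ : ℂ} (hμ : μ * μ = -(c 0 * c 1))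
    (hc : ∀ a, c a ≠ 0) {ε k : ℂ} {X : Module.End ℂ V} (hX : ∀ a v, X (γ a v) = ε • γ a (X v))
    (hk : ∀ x : half γ μ, X x = k • (x : V)) (x y : half γ μ) :
    X (h.split hμ hc (x, y)) = k • ((x : V) + ε • γ 0 y) := by
  rw [split_apply, map_add, hX, hk, hk, map_smul, smul_add, smul_comm ε]

end Commutant

/-- An endomorphism that commutes with a Clifford system on a space of the minimal dimension
`2 ^ (D / 2)` is a scalar. -/
theorem exists_eq_smul_of_commute : ∀ {D : ℕ} {V : Type*} [AddCommGroup V] [Module ℂ V]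
    {c : Fin D → ℂ} {γ : Fin D → Module.End ℂ V}, IsCliffordSystem c γ → (∀ a, c a ≠ 0) →
    Module.finrank ℂ V = 2 ^ (D / 2) → ∀ X : Module.End ℂ V, (∀ a v, X (γ a v) = γ a (X v)) →
    ∃ k : ℂ, ∀ v, X v = k • v
  | 0, V, _, _, _, _, _, _, hV, X, _ => by
    obtain ⟨k, hk, -⟩ := LinearMap.existsUnique_eq_smul_id_of_finrank_eq_one hV X
    exact ⟨k, fun v => by rw [hk]; simp⟩
  | 1, V, _, _, _, _, _, _, hV, X, _ => by
    obtain ⟨k, hk, -⟩ := LinearMap.existsUnique_eq_smul_id_of_finrank_eq_one hV X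
    exact ⟨k, fun v => by rw [hk]; simp⟩
  | D + 2, V, _, _, c, γ, h, hc, hV, X, hX => by
    obtain ⟨μ, hμ⟩ := exists_mul_self_eq (-(c 0 * c 1))
    have hX' : ∀ a v, X (γ a v) = (1 : ℂ) • γ a (X v) := fun a v => by rw [hX, one_smul]
    obtain ⟨k, hk⟩ := exists_eq_smul_of_commute (h.isCliffordSystem_halfSystem μ) (fun a => hc _)
      (h.finrank_half hμ hc hV) (X.restrict fun v hv => map_mem_half (mul_one 1) hX' hv)
      (fun a v => Subtype.ext (hX _ _))
    refine ⟨k, fun v => ?_⟩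
    obtain ⟨⟨x, y⟩, rfl⟩ := (h.split hμ hc).surjective v
    rw [h.map_split hμ hc hX' (fun x => congrArg Subtype.val (hk x)), one_smul, split_apply]

/-- For odd `D`, no non-zero endomorphism anticommutes with all elements of a Clifford system on a
space of the minimal dimension `2 ^ (D / 2)`. -/
theorem eq_zero_of_anticommute : ∀ {D : ℕ} {V : Type*} [AddCommGroup V] [Module ℂ V]
    {c : Fin D → ℂ} {γ : Fin D → Module.End ℂ V}, Odd D → IsCliffordSystem c γ →
    (∀ a, c a ≠ 0) → Module.finrank ℂ V = 2 ^ (D / 2) → ∀ X : Module.End ℂ V,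
    (∀ a v, X (γ a v) = -γ a (X v)) → ∀ v, X v = 0
  | 0, _, _, _, _, _, hD, _, _, _, _, _ => absurd hD (by decide)
  | 1, V, _, _, c, γ, _, h, hc, hV, X, hX => fun v => by
    obtain ⟨k, hk, -⟩ := LinearMap.existsUnique_eq_smul_id_of_finrank_eq_one hV (γ 0)
    have h1 := hX 0 (γ 0 v)
    rw [h.sq, hk] at h1
    have h2 := h.sq 0 (X v)
    rw [hk] at h2
    simp only [map_smul, LinearMap.smul_apply, LinearMap.id_coe, id_eq] at h1 h2
    rw [h2] at h1
    rw [eq_neg_iff_add_eq_zero, ← two_smul ℂ, smul_eq_zero_iff_right two_ne_zero] at h1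
    exact (smul_eq_zero_iff_right (hc 0)).1 h1
  | D + 2, V, _, _, c, γ, hD, h, hc, hV, X, hX => fun v => by
    obtain ⟨μ, hμ⟩ := exists_mul_self_eq (-(c 0 * c 1))
    have hX' : ∀ a v, X (γ a v) = (-1 : ℂ) • γ a (X v) := fun a v => by rw [hX, neg_one_smul]
    have h0 := eq_zero_of_anticommute (by simpa [Nat.odd_add] using hD)
      (h.isCliffordSystem_halfSystem μ) (fun a => hc _)
      (h.finrank_half hμ hc hV) (X.restrict fun v hv => map_mem_half (by norm_num) hX' hv)
      (fun a v => Subtype.ext (hX _ _))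
    obtain ⟨⟨x, y⟩, rfl⟩ := (h.split hμ hc).surjective v
    rw [h.map_split hμ hc hX' (k := 0) (fun x => by
      rw [zero_smul]; exact congrArg Subtype.val (h0 x)), zero_smul]

end IsCliffordSystem

/-! ### Dirac matrices -/

section

variable {r s : ℕ}

lemma etaSign_eq_one_or (a : Fin (r + s)) : etaSign r s a = 1 ∨ etaSign r s a = -1 := by
  unfold etaSign
  split_ifs <;> simp

lemma etaSign_ne_zero (a : Fin (r + s)) : etaSign r s a ≠ 0 := by
  rcases etaSign_eq_one_or a with h | h <;> rw [h] <;> norm_num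

lemma etaForm_smul_single_add {a b : Fin (r + s)} (hab : a ≠ b) (x y : ℝ) :
    etaForm r s (x • Pi.single a 1 + y • Pi.single b 1)
      = etaSign r s a * x ^ 2 + etaSign r s b * y ^ 2 := by
  rw [etaForm, QuadraticMap.weightedSumSquares_apply, Fintype.sum_eq_add a b hab]
  · simp [hab, hab.symm, pow_two]
  · rintro c ⟨hca, hcb⟩
    simp [hca, hcb]

lemma etaForm_single (a : Fin (r + s)) : etaForm r s (Pi.single a 1) = etaSign r s a := by
  rw [etaForm, QuadraticMap.weightedSumSquares_apply, Fintype.sum_eq_single a]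
  · simp
  · intro c hca
    simp [hca]

/-- The product of two vectors of square length `± 1` as an element of `Spin(r, s)`. -/
lemma exists_spin_eq_mul {v w : Fin (r + s) → ℝ} (hv : etaForm r s v = 1 ∨ etaForm r s v = -1)
    (hw : etaForm r s w = 1 ∨ etaForm r s w = -1) :
    ∃ h : Spin r s, ((h : (Cl r s)ˣ) : Cl r s) = clι r s v * clι r s w := by
  have unit : ∀ x : Fin (r + s) → ℝ, (etaForm r s x = 1 ∨ etaForm r s x = -1) →
      IsUnit (clι r s x) := fun x hx =>
    CliffordAlgebra.isUnit_ι_of_isUnit (-etaForm r s) (m := x)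
      (by rcases hx with hx | hx <;> simp [hx])
  obtain ⟨u, hu⟩ := (unit v hv).mul (unit w hw)
  exact ⟨⟨u, Subgroup.subset_closure ⟨v, w, hv, hw, hu⟩⟩, hu⟩

namespace DiracMatrices

variable (Γ Γ' Δ : DiracMatrices r s)

lemma mul_self (a : Fin (r + s)) :
    Γ.1 a * Γ.1 a
      = (-etaSign r s a : ℂ) • (1 : Matrix (Fin (dγ r s)) (Fin (dγ r s)) ℂ) := by
  have h := Γ.2 a a
  rw [← two_smul ℂ] at h
  refine smul_right_injective _ (two_ne_zero (α := ℂ)) (h.trans ?_)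
  ext i j
  simp [eta, Matrix.smul_apply, Complex.real_smul, mul_assoc]

lemma mul_anticomm {a b : Fin (r + s)} (hab : a ≠ b) : Γ.1 a * Γ.1 b = -(Γ.1 b * Γ.1 a) := by
  have h := Γ.2 a b
  rwa [eta, Matrix.diagonal_apply_ne _ hab, mul_zero, zero_smul, add_eq_zero_iff_eq_neg] at h

lemma isCliffordSystem :
    IsCliffordSystem (fun a => (-etaSign r s a : ℂ)) fun a => Matrix.toLin' (Γ.1 a) where
  sq a v := by
    rw [← Matrix.toLin'_mul_apply, Γ.mul_self]
    simp [Matrix.smul_mulVec]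
  anticomm a b hab v := by
    rw [← Matrix.toLin'_mul_apply, Γ.mul_anticomm hab, map_neg, LinearMap.neg_apply,
      Matrix.toLin'_mul_apply]

lemma neg_etaSign_ne_zero (a : Fin (r + s)) : (-etaSign r s a : ℂ) ≠ 0 :=
  neg_ne_zero.2 (Complex.ofReal_ne_zero.2 (etaSign_ne_zero a))

theorem nonempty (r s : ℕ) : Nonempty (DiracMatrices r s) := by
  obtain ⟨γ, hγ⟩ := IsCliffordSystem.exists_of_squares
    (fun a : Fin (r + s) => (-etaSign r s a : ℂ)) neg_etaSign_ne_zero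
  refine ⟨⟨fun a => LinearMap.toMatrix' (γ a), fun a b => ?_⟩⟩
  rw [← LinearMap.toMatrix'_mul, ← LinearMap.toMatrix'_mul, ← map_add]
  apply Matrix.toLin'.injective
  rw [Matrix.toLin'_toMatrix']
  refine LinearMap.ext fun v => ?_
  rw [LinearMap.add_apply, Module.End.mul_apply, Module.End.mul_apply]
  rcases eq_or_ne a b with rfl | hab
  · rw [hγ.sq, ← two_smul ℂ, smul_smul]
    ext i
    simp [eta, Matrix.smul_mulVec]
  · rw [hγ.anticomm a b hab, neg_add_cancel, eta, Matrix.diagonal_apply_ne _ hab]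
    simp

/-- Pauli's theorem: two sets of Dirac matrices are conjugate, in odd dimension up to a sign. -/
theorem exists_conj : ∃ (S : GL (Fin (dγ r s)) ℂ) (ε : ℂ), (ε = 1 ∨ ε = -1) ∧
    (Even (r + s) → ε = 1) ∧ ∀ a, Γ'.1 a * S.1 = ε • (S.1 * Γ.1 a) := by
  obtain ⟨T, ε, hε, hD, hT⟩ := IsCliffordSystem.exists_intertwiner Γ.isCliffordSystem
    Γ'.isCliffordSystem neg_etaSign_ne_zero (Module.finrank_fin_fun ℂ) (Module.finrank_fin_fun ℂ)
  refine ⟨⟨LinearMap.toMatrix' T, LinearMap.toMatrix' T.symm, ?_, ?_⟩, ε, hε, hD, fun a => ?_⟩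
  · simp [← LinearMap.toMatrix'_comp]
  · simp [← LinearMap.toMatrix'_comp]
  · apply Matrix.toLin'.injective
    refine LinearMap.ext fun v => ?_
    simpa [Matrix.toLin'_mul] using hT a v

/-- Schur's lemma for a set of Dirac matrices. -/
theorem exists_eq_smul_one_of_commute {X : Matrix (Fin (dγ r s)) (Fin (dγ r s)) ℂ}
    (hX : ∀ a, X * Γ.1 a = Γ.1 a * X) : ∃ k : ℂ, X = k • 1 := by
  obtain ⟨k, hk⟩ := IsCliffordSystem.exists_eq_smul_of_commute Γ.isCliffordSystem
    neg_etaSign_ne_zero (Module.finrank_fin_fun ℂ) (Matrix.toLin' X) fun a v => by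
      rw [← Matrix.toLin'_mul_apply, hX, Matrix.toLin'_mul_apply]
  refine ⟨k, Matrix.toLin'.injective (LinearMap.ext fun v => ?_)⟩
  simpa using hk v

lemma slash_single (a : Fin (r + s)) : Γ.slash (Pi.single a 1) = Γ.1 a := by
  change ∑ b, (Pi.single a 1 : Fin (r + s) → ℝ) b • Γ.1 b = Γ.1 a
  rw [Fintype.sum_eq_single a]
  · simp
  · intro b hb
    simp [hb]

lemma cliffordRep_clι (v : Fin (r + s) → ℝ) : Γ.cliffordRep (clι r s v) = Γ.slash v :=
  CliffordAlgebra.lift_ι_apply _ _ v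

/-- The matrices `Γ.slash v` are equivariant with respect to the spin representation. -/
lemma spinRep_mul_slash (h : Spin r s) (v : Fin (r + s) → ℝ) :
    (Γ.spinRep h).1 * Γ.slash v = Γ.slash (spinCover r s h v) * (Γ.spinRep h).1 := by
  change Γ.cliffordRep (h : (Cl r s)ˣ) * Γ.slash v
    = Γ.slash (spinCoverFun r s h v) * Γ.cliffordRep (h : (Cl r s)ˣ)
  rw [← cliffordRep_clι, ← cliffordRep_clι, spinCoverFun_spec, ← map_mul, ← map_mul,
    Units.inv_mul_cancel_right]

/-- Two sets of Dirac matrices whose products `Γ a * Γ b` are intertwined by `S` define spin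
representations that are intertwined by `S`. -/
theorem mul_spinRep_of_forall_mul {S : GL (Fin (dγ r s)) ℂ}
    (hS : ∀ a b, Γ'.1 a * Γ'.1 b * S.1 = S.1 * (Γ.1 a * Γ.1 b)) (h : Spin r s) :
    S.1 * (Γ.spinRep h).1 = (Γ'.spinRep h).1 * S.1 := by
  have hvw : ∀ v w, Γ'.slash v * Γ'.slash w * S.1 = S.1 * (Γ.slash v * Γ.slash w) := fun v w => by
    simp only [slash, LinearMap.coe_mk, AddHom.coe_mk, Finset.sum_mul, Finset.mul_sum,
      smul_mul_assoc, mul_smul_comm, hS]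
  have key : Set.EqOn
      ((MulAut.conj S).toMonoidHom.comp (Units.map (Γ.cliffordRep : Cl r s →* _)))
      (Units.map (Γ'.cliffordRep : Cl r s →* _)) (Spin r s) := by
    refine MonoidHom.eqOn_closure ?_
    rintro u ⟨v, w, -, -, hu⟩
    change S * _ * S⁻¹ = _
    rw [mul_inv_eq_iff_eq_mul]
    refine Units.ext ?_
    change S.1 * Γ.cliffordRep (u : Cl r s) = Γ'.cliffordRep (u : Cl r s) * S.1
    rw [hu, map_mul, map_mul, cliffordRep_clι, cliffordRep_clι, cliffordRep_clι, cliffordRep_clι,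
      hvw]
  have hk : S * Γ.spinRep h * S⁻¹ = Γ'.spinRep h := key h.2
  rw [mul_inv_eq_iff_eq_mul] at hk
  exact congrArg Units.val hk

lemma eq_zero_of_smul_add_smul {a b : Fin (r + s)} (hab : a ≠ b) {x y : ℂ}
    (h : x • Γ.1 a + y • Γ.1 b = 0) : x = 0 := by
  have h1 : (x • Γ.1 a + y • Γ.1 b) * Γ.1 a + Γ.1 a * (x • Γ.1 a + y • Γ.1 b) = 0 := by
    rw [h, zero_mul, mul_zero, add_zero]
  simp only [add_mul, mul_add, smul_mul_assoc, mul_smul_comm, Γ.mul_self,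
    Γ.mul_anticomm hab] at h1
  have h2 : (2 * x * -etaSign r s a : ℂ)
      • (1 : Matrix (Fin (dγ r s)) (Fin (dγ r s)) ℂ) = 0 := by
    rw [← h1]
    module
  have h3 := (smul_eq_zero_iff_left one_ne_zero).1 h2
  simpa [etaSign_ne_zero] using h3

/-- The Dirac matrices are determined by the spin representation up to a change that does not
affect their even products: if `Δ.slash` is equivariant with respect to the representation defined
by `Γ`, then `Γ a * Γ b = Δ a * Δ b`. By Schur's lemma the two spin representations differ by a
scalar at each element of the group. That the scalar at `e_a * e_b` is `1` is seen from the elements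
`e_a * (x e_a + y e_b)`. -/
theorem mul_eq_mul_of_equivariant
    (H : ∀ (h : Spin r s) v,
      (Γ.spinRep h).1 * Δ.slash v = Δ.slash (spinCover r s h v) * (Γ.spinRep h).1)
    (a b : Fin (r + s)) : Γ.1 a * Γ.1 b = Δ.1 a * Δ.1 b := by
  have scalar : ∀ v w, (etaForm r s v = 1 ∨ etaForm r s v = -1) →
      (etaForm r s w = 1 ∨ etaForm r s w = -1) →
      ∃ k : ℂ, Γ.slash v * Γ.slash w = k • (Δ.slash v * Δ.slash w) := by
    intro v w hv hw
    obtain ⟨h, hh⟩ := exists_spin_eq_mul hv hw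
    obtain ⟨k, hk⟩ := Δ.exists_eq_smul_one_of_commute
      (X := ((Δ.spinRep h)⁻¹).1 * (Γ.spinRep h).1) fun a => by
        rw [← slash_single, mul_assoc, H, Units.inv_mul_eq_iff_eq_mul, ← mul_assoc, ← mul_assoc,
          spinRep_mul_slash, mul_assoc (Δ.slash _), Units.mul_inv, mul_one]
    refine ⟨k, ?_⟩
    rw [Units.inv_mul_eq_iff_eq_mul, mul_smul_comm, mul_one, spinRep_val, spinRep_val, hh] at hk
    simpa only [map_mul, cliffordRep_clι] using hk
  rcases eq_or_ne a b with rfl | hab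
  · rw [mul_self, mul_self]
  have ha : etaForm r s (Pi.single a 1) = 1 ∨ etaForm r s (Pi.single a 1) = -1 := by
    rw [etaForm_single]; exact etaSign_eq_one_or a
  have hb : etaForm r s (Pi.single b 1) = 1 ∨ etaForm r s (Pi.single b 1) = -1 := by
    rw [etaForm_single]; exact etaSign_eq_one_or b
  -- A unit vector in the plane of `e_a` and `e_b`, neither of whose components vanishes; the
  -- plane may be definite or Lorentzian.
  obtain ⟨x, y, hx, hy, hxy⟩ : ∃ x y : ℝ, x ≠ 0 ∧ y ≠ 0 ∧
      etaSign r s a * x ^ 2 + etaSign r s b * y ^ 2 = etaSign r s a := by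
    by_cases hs : etaSign r s a = etaSign r s b
    · exact ⟨3 / 5, 4 / 5, by norm_num, by norm_num, by rw [← hs]; ring⟩
    · have hs' : etaSign r s b = -etaSign r s a := by
        rcases etaSign_eq_one_or a with h | h <;> rcases etaSign_eq_one_or b with h' | h' <;>
          simp_all
      exact ⟨5 / 4, 3 / 4, by norm_num, by norm_num, by rw [hs']; ring⟩
  obtain ⟨l, hl⟩ := scalar _ _ ha hb
  obtain ⟨k, hk⟩ := scalar _ (x • Pi.single a 1 + y • Pi.single b 1) ha (by
    rw [etaForm_smul_single_add hab, hxy]; exact etaSign_eq_one_or a)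
  simp only [map_add, map_smul, slash_single] at hl hk
  simp only [mul_add, mul_smul_comm, hl, mul_self] at hk
  have hk' : (x * (1 - k) : ℂ) • Δ.1 a + (y * (l - k) : ℂ) • Δ.1 b = 0 := by
    have h0 : Δ.1 a * (Δ.1 a * ((x * (1 - k) : ℂ) • Δ.1 a + (y * (l - k) : ℂ) • Δ.1 b)) = 0 := by
      rw [mul_add, mul_smul_comm, mul_smul_comm, mul_self]
      rw [← sub_eq_zero] at hk
      refine (congrArg (Δ.1 a * ·) ?_).trans (mul_zero _)
      refine Eq.trans ?_ hk
      simp only [← Complex.coe_smul]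
      module
    rw [← mul_assoc, mul_self, smul_mul_assoc, one_mul] at h0
    exact (smul_eq_zero_iff_right (neg_etaSign_ne_zero a)).1 h0
  have h1 := eq_zero_of_smul_add_smul Δ hab hk'
  have h2 := eq_zero_of_smul_add_smul Δ hab.symm ((add_comm _ _).trans hk')
  have hk1 : k = 1 := by
    have := (mul_eq_zero.1 h1).resolve_left (Complex.ofReal_ne_zero.2 hx)
    exact (sub_eq_zero.1 this).symm
  have hl1 : l = 1 := by
    have := (mul_eq_zero.1 h2).resolve_left (Complex.ofReal_ne_zero.2 hy)
    exact (sub_eq_zero.1 this).trans hk1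
  rw [hl, hl1, one_smul]

/-- If `Δ.slash` and `Δ'.slash` are equivariant for the spin representations defined by `Γ` and `Γ'`,
then a matrix that conjugates `Δ` to `± Δ'` intertwines the two spin representations. -/
theorem exists_conj_of_equivariant (Δ' : DiracMatrices r s)
    (H : ∀ (h : Spin r s) v,
      (Γ.spinRep h).1 * Δ.slash v = Δ.slash (spinCover r s h v) * (Γ.spinRep h).1)
    (H' : ∀ (h : Spin r s) v,
      (Γ'.spinRep h).1 * Δ'.slash v = Δ'.slash (spinCover r s h v) * (Γ'.spinRep h).1) :
    ∃ (S : GL (Fin (dγ r s)) ℂ) (ε : ℂ), (ε = 1 ∨ ε = -1) ∧ (Even (r + s) → ε = 1) ∧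
      (∀ a, Δ'.1 a * S.1 = ε • (S.1 * Δ.1 a)) ∧
      ∀ h, S.1 * (Γ.spinRep h).1 = (Γ'.spinRep h).1 * S.1 := by
  obtain ⟨S, ε, hε, hD, hS⟩ := exists_conj Δ Δ'
  refine ⟨S, ε, hε, hD, hS, mul_spinRep_of_forall_mul Γ Γ' fun a b => ?_⟩
  have hεε : ε * ε = 1 := by rcases hε with rfl | rfl <;> norm_num
  rw [mul_eq_mul_of_equivariant Γ Δ H, mul_eq_mul_of_equivariant Γ' Δ' H', mul_assoc, hS,
    mul_smul_comm, ← mul_assoc, hS, smul_mul_assoc, smul_smul, hεε, one_smul, mul_assoc]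

end DiracMatrices

end

/-! ### Dirac structures on spinor bundles -/

namespace SOFrame

variable {r s : ℕ} {M : Type u} [TopologicalSpace M]
  [ChartedSpace (EuclideanSpace ℝ (Fin (r + s))) M] [IsManifold (𝓡 (r + s)) ∞ M]
  {g : PseudoRiemannianMetric r s M} {o : ManifoldOrientation (r + s) M} {x : M}
  (e : SOFrame g o x)

lemma toEquiv_eq_sum (v : Fin (r + s) → ℝ) : e.toEquiv v = ∑ a, v a • e.basis a :=
  e.basis.equivFun_symm_apply v

lemma toEquiv_single (a : Fin (r + s)) : e.toEquiv (Pi.single a 1) = e.basis a := by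
  rw [toEquiv_eq_sum, Fintype.sum_eq_single a]
  · simp
  · intro b hb
    simp [hb]

lemma inner_toEquiv (v w : Fin (r + s) → ℝ) :
    g.inner x (e.toEquiv v) (e.toEquiv w) = ∑ a, ∑ b, v a * w b * eta r s a b := by
  simp only [toEquiv_eq_sum, map_sum, map_smul, FunLike.coe_sum, Finset.sum_apply,
    FunLike.coe_smul, Pi.smul_apply, e.orthonormal, smul_eq_mul, Finset.mul_sum]
  rw [Finset.sum_comm]
  refine Finset.sum_congr rfl fun a _ => Finset.sum_congr rfl fun b _ => by ring

lemma toEquiv_symm_apply (X : TangentSpace (𝓡 (r + s)) x) (a : Fin (r + s)) :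
    e.toEquiv.symm X a = etaSign r s a * g.inner x X (e.basis a) := by
  obtain ⟨v, rfl⟩ := e.toEquiv.surjective X
  have hη : etaSign r s a * etaSign r s a = 1 := by
    rcases etaSign_eq_one_or a with h | h <;> rw [h] <;> norm_num
  rw [LinearEquiv.symm_apply_apply, ← toEquiv_single, inner_toEquiv, Fintype.sum_eq_single a,
    Fintype.sum_eq_single a]
  · simp [eta, mul_left_comm, hη]
  · intro b hb
    simp [hb]
  · intro b hb
    refine Finset.sum_eq_zero fun c _ => ?_
    rcases eq_or_ne c a with rfl | hc
    · simp [eta, Matrix.diagonal_apply_ne _ hb]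
    · simp [hc]

end SOFrame

lemma PseudoRiemannianMetric.contMDiffOn_inner {r s : ℕ} {M : Type u} [TopologicalSpace M]
    [ChartedSpace (EuclideanSpace ℝ (Fin (r + s))) M] [IsManifold (𝓡 (r + s)) ∞ M]
    (g : PseudoRiemannianMetric r s M) {X Y : ∀ x : M, TangentSpace (𝓡 (r + s)) x} {U : Set M}
    (hX : IsSmoothVectorField X U) (hY : IsSmoothVectorField Y U) :
    ContMDiffOn (𝓡 (r + s)) 𝓘(ℝ, ℝ) ∞ (fun x => g.inner x (X x) (Y x)) U := by
  intro x hx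
  have : ContMDiffWithinAt (𝓡 (r + s)) ((𝓡 (r + s)).prod 𝓘(ℝ, ℝ)) ∞
      (fun m ↦ Bundle.TotalSpace.mk' ℝ (E := Bundle.Trivial M ℝ) m (g.inner m (X m) (Y m))) U x := by
    apply ContMDiffWithinAt.clm_bundle_apply₂ (F₁ := EuclideanSpace ℝ (Fin (r + s)))
      (F₂ := EuclideanSpace ℝ (Fin (r + s)))
    · exact g.contMDiff.contMDiffAt.contMDiffWithinAt
    · exact hX x hx
    · exact hY x hx
  simp only [Bundle.contMDiffWithinAt_totalSpace] at this
  exact this.2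

namespace DiracMatrices

variable {r s : ℕ} (Γ : DiracMatrices r s)

lemma slash_anticomm (v w : Fin (r + s) → ℝ) :
    Γ.slash v * Γ.slash w + Γ.slash w * Γ.slash v
      = ((-2 * ∑ a, ∑ b, v a * w b * eta r s a b : ℝ) : ℂ)
        • (1 : Matrix (Fin (dγ r s)) (Fin (dγ r s)) ℂ) := by
  have e1 : ∀ v w : Fin (r + s) → ℝ, Γ.slash v * Γ.slash w
      = ∑ a, ∑ b, (v a * w b) • (Γ.1 a * Γ.1 b) := fun v w => by
    simp [slash, Finset.sum_mul_sum, smul_smul, mul_comm]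
  rw [e1 v w, e1 w v, Finset.sum_comm (f := fun a b => (w a * v b) • (Γ.1 a * Γ.1 b)),
    ← Finset.sum_add_distrib, Complex.coe_smul, Finset.mul_sum, Finset.sum_smul]
  refine Finset.sum_congr rfl fun a _ => ?_
  rw [← Finset.sum_add_distrib, Finset.mul_sum, Finset.sum_smul]
  refine Finset.sum_congr rfl fun b _ => ?_
  rw [mul_comm (w b), ← smul_add, Γ.2 a b, smul_smul]
  congr 1
  ring

end DiracMatrices

/-- What spin structures and `Spin^c` structures on `(M, g)` have in common as far as spinors are
concerned: a principal bundle with an equivariant smooth map to `SO(M)`, whose structure group `G`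
contains the image of `Spin(r, s)` and acts on spinors by scalar multiples of elements of that
image. -/
structure SpinorFrames {r s : ℕ} {M : Type u} [TopologicalSpace M]
    [ChartedSpace (EuclideanSpace ℝ (Fin (r + s))) M] [IsManifold (𝓡 (r + s)) ∞ M]
    (g : PseudoRiemannianMetric r s M) (o : ManifoldOrientation (r + s) M)
    (G : Type) [Group G] (Smooth : (M → G) → Set M → Prop) where
  /-- the bundle of spinor frames -/
  bundle : PrincipalBundle.{u, 0, w, w'} M G Smooth
  /-- the bundle map to `SO(M)` -/
  Φ : ∀ {x : M}, bundle.Fiber x → SOFrame g o x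
  /-- the homomorphism to `SO(r, s)` -/
  cover : G →* Module.End ℝ (Fin (r + s) → ℝ)
  /-- the spinor representation given by a set of Dirac matrices -/
  rep : DiracMatrices r s → G →* GL (Fin (dγ r s)) ℂ
  equivariant : ∀ {x : M} (p : bundle.Fiber x) (h : G) (v : Fin (r + s) → ℝ),
    (Φ (bundle.act p h)).toEquiv v = (Φ p).toEquiv (cover h v)
  smooth : ∀ (i : bundle.Idx) (a : Fin (r + s)),
    IsSmoothVectorField (fun x => (Φ (bundle.sec i x)).basis a) (bundle.dom i)
  smooth_rep : ∀ (Γ : DiracMatrices r s) (f : M → G) (U : Set M), Smooth f U → ∀ a b,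
    ContMDiffOn (𝓡 (r + s)) 𝓘(ℝ, ℂ) ∞
      (fun x => (rep Γ (f x) : Matrix (Fin (dγ r s)) (Fin (dγ r s)) ℂ) a b) U
  exists_of_spin : ∀ k : Spin r s, ∃ h : G, cover h = spinCover r s k ∧
    ∀ Γ, rep Γ h = DiracMatrices.spinRep Γ k
  exists_spin_smul : ∀ h : G, ∃ (k : Spin r s) (z : ℂ), cover h = spinCover r s k ∧
    ∀ Γ, (rep Γ h).1 = z • (DiracMatrices.spinRep Γ k).1

namespace SpinorFrames

variable {r s : ℕ} {M : Type u} [TopologicalSpace M]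
  [ChartedSpace (EuclideanSpace ℝ (Fin (r + s))) M] [IsManifold (𝓡 (r + s)) ∞ M]
  {g : PseudoRiemannianMetric r s M} {o : ManifoldOrientation (r + s) M}
  {G : Type} [Group G] {Smooth : (M → G) → Set M → Prop}
  (F : SpinorFrames.{u, w, w'} g o G Smooth) (Γ Γ' : DiracMatrices r s)

lemma rep_mul_slash (h : G) (v : Fin (r + s) → ℝ) :
    (F.rep Γ h).1 * Γ.slash v = Γ.slash (F.cover h v) * (F.rep Γ h).1 := by
  obtain ⟨k, z, hk, hz⟩ := F.exists_spin_smul h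
  rw [hk, hz, smul_mul_assoc, Γ.spinRep_mul_slash, mul_smul_comm]

/-- The spinor bundle. -/
def spinorBundle : CVectorBundle.{u, w, w'} (n := r + s) M (dγ r s) :=
  F.bundle.associated (F.rep Γ) (F.smooth_rep Γ)

/-- The spinor `[p, v]`, as a linear isomorphism in `v`. -/
def spinor {x : M} (p : F.bundle.Fiber x) :
    (Fin (dγ r s) → ℂ) ≃ₗ[ℂ] (F.spinorBundle Γ).Fiber x :=
  F.bundle.assocFrame (F.rep Γ) p

lemma spinor_act {x : M} (p : F.bundle.Fiber x) (h : G) (v : Fin (dγ r s) → ℂ) :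
    F.spinor Γ (F.bundle.act p h) v = F.spinor Γ p ((F.rep Γ h).1 *ᵥ v) :=
  F.bundle.assocMk_act (F.rep Γ) p h v

variable {Γ Γ'}

/-- The section `γ` is given by the constant matrices `Δ` in all spinor frames. -/
def HasConstantMatrices (γ : EndValuedForm r s (F.spinorBundle Γ))
    (Δ : Fin (r + s) → Matrix (Fin (dγ r s)) (Fin (dγ r s)) ℂ) : Prop :=
  ∀ (x : M) (p : F.bundle.Fiber x) (a : Fin (r + s)) (v : Fin (dγ r s) → ℂ),
    γ x ((F.Φ p).basis a) (F.spinor Γ p v) = F.spinor Γ p (Δ a *ᵥ v)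

lemma HasConstantMatrices.apply_toEquiv {γ : EndValuedForm r s (F.spinorBundle Γ)}
    {Δ : DiracMatrices r s} (h : F.HasConstantMatrices γ Δ.1) {x : M} (p : F.bundle.Fiber x)
    (v : Fin (r + s) → ℝ) (ψ : Fin (dγ r s) → ℂ) :
    γ x ((F.Φ p).toEquiv v) (F.spinor Γ p ψ) = F.spinor Γ p (Δ.slash v *ᵥ ψ) := by
  have hs : Δ.slash v = ∑ a, (v a : ℂ) • Δ.1 a := by
    change ∑ a, v a • Δ.1 a = _
    exact Finset.sum_congr rfl fun a _ => (Complex.coe_smul (v a) (Δ.1 a)).symm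
  rw [SOFrame.toEquiv_eq_sum, map_sum, LinearMap.sum_apply, hs, Matrix.sum_mulVec, map_sum]
  refine Finset.sum_congr rfl fun a _ => ?_
  rw [map_smul, ← Complex.coe_smul, LinearMap.smul_apply, h, Matrix.smul_mulVec, map_smul]

variable (Γ) in
/-- Clifford multiplication defined by `Γ`, expressed in one spinor frame at each point. -/
def diracForm : EndValuedForm r s (F.spinorBundle Γ) := fun x =>
  { toFun := fun X => (F.spinor Γ (F.bundle.somePoint x)).conj
      (Matrix.toLin' (Γ.slash ((F.Φ (F.bundle.somePoint x)).toEquiv.symm X)))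
    map_add' := fun X Y => by simp only [map_add]
    map_smul' := fun c X => by
      rw [map_smul, map_smul, ← Complex.coe_smul, map_smul, map_smul, Complex.coe_smul]
      rfl }

/-- Clifford multiplication has the same form in all spinor frames, since `Γ.slash` is
equivariant. -/
lemma diracForm_apply {x : M} (p : F.bundle.Fiber x) (X : TangentSpace (𝓡 (r + s)) x)
    (ψ : Fin (dγ r s) → ℂ) :
    F.diracForm Γ x X (F.spinor Γ p ψ)
      = F.spinor Γ p (Γ.slash ((F.Φ p).toEquiv.symm X) *ᵥ ψ) := by
  obtain ⟨h, rfl⟩ := F.bundle.transitive (F.bundle.somePoint x) p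
  obtain ⟨v, rfl⟩ := (F.Φ (F.bundle.act (F.bundle.somePoint x) h)).toEquiv.surjective X
  rw [LinearEquiv.symm_apply_apply, F.equivariant, spinor_act, spinor_act]
  change (F.spinor Γ (F.bundle.somePoint x)).conj (Matrix.toLin' (Γ.slash
    ((F.Φ (F.bundle.somePoint x)).toEquiv.symm _))) _ = _
  rw [LinearEquiv.symm_apply_apply, LinearEquiv.conj_apply_apply, LinearEquiv.symm_apply_apply,
    Matrix.toLin'_apply, Matrix.mulVec_mulVec, Matrix.mulVec_mulVec, F.rep_mul_slash]

lemma hasConstantMatrices_diracForm : F.HasConstantMatrices (F.diracForm Γ) Γ.1 :=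
  fun x p a v => by
    rw [diracForm_apply, ← SOFrame.toEquiv_single, LinearEquiv.symm_apply_apply,
      Γ.slash_single]

lemma isDiracStructure_diracForm : IsDiracStructure g (F.spinorBundle Γ) (F.diracForm Γ) where
  smooth i W hW hWi X hX a b := by
    -- The components of `X` in the orthonormal frame are smooth, being scalar products.
    have hc : ContMDiffOn (𝓡 (r + s)) 𝓘(ℝ, Fin (r + s) → ℝ) ∞
        (fun x => (F.Φ (F.bundle.sec i x)).toEquiv.symm (X x)) W := by
      rw [contMDiffOn_pi_space]
      intro c
      have hin := g.contMDiffOn_inner hX ((F.smooth i c).mono hWi)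
      have hl : ContDiff ℝ ∞ fun t : ℝ => etaSign r s c * t := contDiff_const.mul contDiff_id
      exact (hl.contMDiff.comp_contMDiffOn hin).congr fun x _ =>
        SOFrame.toEquiv_symm_apply _ _ _
    let entry : (Fin (r + s) → ℝ) →ₗ[ℝ] ℂ := (Matrix.entryLinearMap ℝ ℂ a b).comp Γ.slash
    refine ((LinearMap.toContinuousLinearMap entry).contDiff.contMDiff.comp_contMDiffOn hc).congr
      fun x _ => ?_
    change (F.spinor Γ (F.bundle.sec i x)).symm (F.diracForm Γ x (X x)
      (F.spinor Γ (F.bundle.sec i x) (Pi.single b 1))) a = _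
    rw [diracForm_apply, LinearEquiv.symm_apply_apply, Matrix.mulVec_single_one]
    rfl
  clifford x X Y := by
    refine LinearMap.ext fun ψ => ?_
    let p := F.bundle.somePoint x
    obtain ⟨ψ, rfl⟩ := (F.spinor Γ p).surjective ψ
    obtain ⟨v, rfl⟩ := (F.Φ p).toEquiv.surjective X
    obtain ⟨w, rfl⟩ := (F.Φ p).toEquiv.surjective Y
    rw [LinearMap.add_apply, Module.End.mul_apply, Module.End.mul_apply, diracForm_apply,
      diracForm_apply, diracForm_apply, diracForm_apply, LinearEquiv.symm_apply_apply,
      LinearEquiv.symm_apply_apply, ← map_add, Matrix.mulVec_mulVec, Matrix.mulVec_mulVec,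
      ← Matrix.add_mulVec, Γ.slash_anticomm, SOFrame.inner_toEquiv, Matrix.smul_mulVec,
      Matrix.one_mulVec, map_smul]
    rfl

lemma HasConstantMatrices.eq_of {Δ : DiracMatrices r s}
    {γ γ' : EndValuedForm r s (F.spinorBundle Γ)} (h : F.HasConstantMatrices γ Δ.1)
    (h' : F.HasConstantMatrices γ' Δ.1) : γ' = γ := by
  refine funext fun x => LinearMap.ext fun X => LinearMap.ext fun ψ => ?_
  let p := F.bundle.somePoint x
  obtain ⟨ψ, rfl⟩ := (F.spinor Γ p).surjective ψ
  obtain ⟨v, rfl⟩ := (F.Φ p).toEquiv.surjective X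
  rw [h.apply_toEquiv, h'.apply_toEquiv]

/-- The constant matrices of a Dirac structure form a set of Dirac matrices. -/
lemma HasConstantMatrices.isDiracMatrices [Nonempty M]
    {γ : EndValuedForm r s (F.spinorBundle Γ)}
    {Δ : Fin (r + s) → Matrix (Fin (dγ r s)) (Fin (dγ r s)) ℂ}
    (h : F.HasConstantMatrices γ Δ) (hγ : IsDiracStructure g (F.spinorBundle Γ) γ) :
    IsDiracMatrices r s Δ := by
  intro a b
  obtain ⟨x⟩ := ‹Nonempty M›
  let p := F.bundle.somePoint x
  apply Matrix.toLin'.injective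
  refine LinearMap.ext fun ψ => (F.spinor Γ p).injective ?_
  have hc := congrArg (fun A => A (F.spinor Γ p ψ))
    (hγ.clifford x ((F.Φ p).basis a) ((F.Φ p).basis b))
  simp only [LinearMap.add_apply, Module.End.mul_apply, h x p, (F.Φ p).orthonormal] at hc
  rw [Matrix.toLin'_apply, Matrix.add_mulVec, map_add, ← Matrix.mulVec_mulVec,
    ← Matrix.mulVec_mulVec, hc, ← Complex.coe_smul, map_smul, Matrix.toLin'_one,
    LinearMap.smul_apply, LinearMap.smul_apply, map_smul]
  rfl

/-- The constant matrices of a section are equivariant with respect to the spinor representation,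
since they are the same in the frames `p` and `p h`. -/
lemma HasConstantMatrices.rep_mul_slash [Nonempty M] {Δ : DiracMatrices r s}
    {γ : EndValuedForm r s (F.spinorBundle Γ)} (hγ : F.HasConstantMatrices γ Δ.1)
    (h : G) (v : Fin (r + s) → ℝ) :
    (F.rep Γ h).1 * Δ.slash v = Δ.slash (F.cover h v) * (F.rep Γ h).1 := by
  obtain ⟨x⟩ := ‹Nonempty M›
  let p := F.bundle.somePoint x
  apply Matrix.toLin'.injective
  refine LinearMap.ext fun ψ => (F.spinor Γ p).injective ?_
  rw [Matrix.toLin'_mul_apply, Matrix.toLin'_mul_apply]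
  simp only [Matrix.toLin'_apply]
  rw [← hγ.apply_toEquiv, ← F.equivariant, ← spinor_act, ← spinor_act, hγ.apply_toEquiv]

/-- Natural Dirac structures on two spinor bundles are conjugate by a constant matrix, in odd
dimension up to a sign. -/
theorem exists_conj [Nonempty M] {γ : EndValuedForm r s (F.spinorBundle Γ)}
    {γ' : EndValuedForm r s (F.spinorBundle Γ')}
    (hγ : IsDiracStructure g (F.spinorBundle Γ) γ) (hΔ : ∃ Δ, F.HasConstantMatrices γ Δ)
    (hγ' : IsDiracStructure g (F.spinorBundle Γ') γ') (hΔ' : ∃ Δ, F.HasConstantMatrices γ' Δ) :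
    ∃ (S : GL (Fin (dγ r s)) ℂ) (ε : ℂ) (T : ∀ x : M,
        (F.spinorBundle Γ).Fiber x ≃ₗ[ℂ] (F.spinorBundle Γ').Fiber x),
      (ε = 1 ∨ ε = -1) ∧ (Even (r + s) → ε = 1) ∧
      (∀ (x : M) (p : F.bundle.Fiber x) (v : Fin (dγ r s) → ℂ),
        T x (F.spinor Γ p v) = F.spinor Γ' p (S.1 *ᵥ v)) ∧
      ∀ (x : M) (X : TangentSpace (𝓡 (r + s)) x) (ψ : (F.spinorBundle Γ).Fiber x),
        γ' x X (T x ψ) = ε • T x (γ x X ψ) := by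
  obtain ⟨Δ, hΔ⟩ := hΔ
  obtain ⟨Δ', hΔ'⟩ := hΔ'
  obtain ⟨Δ, rfl⟩ : ∃ Δ₀ : DiracMatrices r s, Δ₀.1 = Δ :=
    ⟨⟨Δ, hΔ.isDiracMatrices F hγ⟩, rfl⟩
  obtain ⟨Δ', rfl⟩ : ∃ Δ₀ : DiracMatrices r s, Δ₀.1 = Δ' :=
    ⟨⟨Δ', hΔ'.isDiracMatrices F hγ'⟩, rfl⟩
  obtain ⟨S, ε, hε, hD, hS, hSρ⟩ := DiracMatrices.exists_conj_of_equivariant Γ Γ' Δ Δ'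
    (fun k v => by
      obtain ⟨h, hk, hrep⟩ := F.exists_of_spin k
      rw [← hk, ← hrep, hΔ.rep_mul_slash])
    (fun k v => by
      obtain ⟨h, hk, hrep⟩ := F.exists_of_spin k
      rw [← hk, ← hrep, hΔ'.rep_mul_slash])
  let T : ∀ x : M, (F.spinorBundle Γ).Fiber x ≃ₗ[ℂ] (F.spinorBundle Γ').Fiber x := fun x =>
    ((F.spinor Γ (F.bundle.somePoint x)).symm.trans
      (Matrix.GeneralLinearGroup.toLin S).toLinearEquiv).trans
      (F.spinor Γ' (F.bundle.somePoint x))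
  have hT : ∀ (x : M) (p : F.bundle.Fiber x) (v : Fin (dγ r s) → ℂ),
      T x (F.spinor Γ p v) = F.spinor Γ' p (S.1 *ᵥ v) := by
    intro x p v
    obtain ⟨h, rfl⟩ := F.bundle.transitive (F.bundle.somePoint x) p
    obtain ⟨k, z, -, hz⟩ := F.exists_spin_smul h
    have hSh : S.1 * (F.rep Γ h).1 = (F.rep Γ' h).1 * S.1 := by
      rw [hz, hz, mul_smul_comm, hSρ, smul_mul_assoc]
    rw [spinor_act, spinor_act, Matrix.mulVec_mulVec, ← hSh, ← Matrix.mulVec_mulVec]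
    simp only [T, LinearEquiv.trans_apply, LinearEquiv.symm_apply_apply]
    rfl
  refine ⟨S, ε, T, hε, hD, hT, fun x X ψ => ?_⟩
  let p := F.bundle.somePoint x
  obtain ⟨ψ, rfl⟩ := (F.spinor Γ p).surjective ψ
  obtain ⟨v, rfl⟩ := (F.Φ p).toEquiv.surjective X
  have hSv : Δ'.slash v * S.1 = ε • (S.1 * Δ.slash v) := by
    simp only [DiracMatrices.slash, LinearMap.coe_mk, AddHom.coe_mk, Finset.sum_mul,
      Finset.mul_sum, Finset.smul_sum, smul_mul_assoc, mul_smul_comm, hS]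
    refine Finset.sum_congr rfl fun a _ => smul_comm _ _ _
  rw [hT, hΔ'.apply_toEquiv, hΔ.apply_toEquiv, hT, Matrix.mulVec_mulVec, hSv,
    Matrix.smul_mulVec, map_smul, Matrix.mulVec_mulVec]

/-- In odd dimension the opposite of a natural Dirac structure is a natural Dirac structure, which
is not conjugate to the given one at any point. -/
theorem neg_not_conj (hD : Odd (r + s)) {γ : EndValuedForm r s (F.spinorBundle Γ)}
    (hγ : IsDiracStructure g (F.spinorBundle Γ) γ) (hΔ : ∃ Δ, F.HasConstantMatrices γ Δ) :
    IsDiracStructure g (F.spinorBundle Γ) (-γ) ∧ (∃ Δ, F.HasConstantMatrices (-γ) Δ) ∧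
      ∀ x : M, ¬ ∃ T : (F.spinorBundle Γ).Fiber x ≃ₗ[ℂ] (F.spinorBundle Γ).Fiber x,
        ∀ (X : TangentSpace (𝓡 (r + s)) x) (ψ : (F.spinorBundle Γ).Fiber x),
          (-γ) x X (T ψ) = T (γ x X ψ) := by
  have hneg : ∀ x X ψ, (-γ) x X ψ = -γ x X ψ := fun _ _ _ => rfl
  refine ⟨⟨fun i W hW hWi X hX a b => ?_, fun x X Y => ?_⟩, ?_, ?_⟩
  · refine (hγ.smooth i W hW hWi X hX a b).neg.congr fun x _ => ?_
    rw [hneg, map_neg]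
    rfl
  · rw [← hγ.clifford x X Y]
    refine LinearMap.ext fun ψ => ?_
    simp only [LinearMap.add_apply, Module.End.mul_apply, hneg, map_neg, neg_neg]
  · obtain ⟨Δ, hΔ⟩ := hΔ
    refine ⟨-Δ, fun x p a v => ?_⟩
    rw [hneg, hΔ, Pi.neg_apply, Matrix.neg_mulVec, map_neg]
  · rintro x ⟨T, hT⟩
    have : Nonempty M := ⟨x⟩
    obtain ⟨Δ, hΔ⟩ := hΔ
    obtain ⟨Δ, rfl⟩ : ∃ Δ₀ : DiracMatrices r s, Δ₀.1 = Δ :=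
      ⟨⟨Δ, hΔ.isDiracMatrices F hγ⟩, rfl⟩
    let p := F.bundle.somePoint x
    have h0 := IsCliffordSystem.eq_zero_of_anticommute hD Δ.isCliffordSystem
      DiracMatrices.neg_etaSign_ne_zero (Module.finrank_fin_fun ℂ)
      ((F.spinor Γ p).symm.conj T.toLinearMap) fun a ψ => by
        apply (F.spinor Γ p).injective
        rw [Matrix.toLin'_apply, Matrix.toLin'_apply, map_neg, ← hΔ]
        simp only [LinearEquiv.conj_apply_apply, LinearEquiv.symm_symm,
          LinearEquiv.apply_symm_apply, LinearEquiv.coe_coe]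
        rw [← hΔ, ← hT, hneg]
    have hpos : 0 < dγ r s := by positivity
    have h1 := h0 (Pi.single ⟨0, hpos⟩ 1)
    rw [LinearEquiv.conj_apply_apply, LinearEquiv.coe_coe, LinearEquiv.symm_symm] at h1
    simp only [EmbeddingLike.map_eq_zero_iff, Pi.single_eq_zero_iff, one_ne_zero] at h1

end SpinorFrames

section Instances

variable {r s : ℕ} {M : Type u} [TopologicalSpace M]
  [ChartedSpace (EuclideanSpace ℝ (Fin (r + s))) M] [IsManifold (𝓡 (r + s)) ∞ M]
  {g : PseudoRiemannianMetric r s M} {o : ManifoldOrientation (r + s) M}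

/-- The spinor frames of a spin structure. -/
def SpinStructure.spinorFrames (σ : SpinStructure.{u, w, w'} g o) :
    SpinorFrames.{u, w, w'} g o (Spin r s) SmoothToSpin where
  bundle := σ.bundle
  Φ := σ.Φ
  cover := spinCover r s
  rep := DiracMatrices.spinRep
  equivariant := σ.equivariant
  smooth := σ.smooth
  smooth_rep := smooth_spinRep
  exists_of_spin k := ⟨k, rfl, fun _ => rfl⟩
  exists_spin_smul h := ⟨h, 1, rfl, fun _ => (one_smul ℂ _).symm⟩

/-- The spinor frames of a `Spin^c` structure. -/
def SpinCStructure.spinorFrames (σ : SpinCStructure.{u, w, w'} g o) :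
    SpinorFrames.{u, w, w'} g o (SpinC r s) SmoothToSpinC where
  bundle := σ.bundle
  Φ := σ.Φ
  cover := spinCCover r s
  rep := DiracMatrices.spinCRep
  equivariant := σ.equivariant
  smooth := σ.smooth
  smooth_rep := smooth_spinCRep
  exists_of_spin k := by
    refine ⟨SpinC.mk r s (k, 1), rfl, fun Γ => Units.ext ?_⟩
    rw [DiracMatrices.spinCRep_mk, Circle.coe_one, one_smul, DiracMatrices.spinRep_val]
  exists_spin_smul h := by
    obtain ⟨⟨k, z⟩, rfl⟩ := QuotientGroup.mk_surjective h
    exact ⟨k, z, rfl, fun Γ => Γ.spinCRep_mk k z⟩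

end Instances

end

theorem theorem1 (r s : ℕ) (hD : 3 ≤ r + s)
    (M : Type u) [TopologicalSpace M] [T2Space M] [ParacompactSpace M] [ConnectedSpace M]
    [ChartedSpace (EuclideanSpace ℝ (Fin (r + s))) M] [IsManifold (𝓡 (r + s)) ∞ M]
    (g : PseudoRiemannianMetric r s M) (o : ManifoldOrientation (r + s) M) :
    -- standard Dirac matrices of size `d_γ` exist
    Nonempty (DiracMatrices r s) ∧
    -- the case of a spin structure
    (∀ σ : SpinStructure.{u, w, w'} g o,
      -- existence: every choice of standard Dirac matrices, used as constant matrices in all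
      -- spin frames, gives one and only one global section, and this is a Dirac structure
      (∀ Γ : DiracMatrices r s, ∃ γ : EndValuedForm r s (σ.spinorBundle Γ),
        IsDiracStructure g (σ.spinorBundle Γ) γ ∧ σ.HasConstantMatrices γ Γ.1 ∧
        ∀ γ', σ.HasConstantMatrices γ' Γ.1 → γ' = γ) ∧
      -- uniqueness up to a global conjugation and, in odd dimension only, a sign
      (∀ (Γ Γ' : DiracMatrices r s) (γ : EndValuedForm r s (σ.spinorBundle Γ))
        (γ' : EndValuedForm r s (σ.spinorBundle Γ')),
        IsDiracStructure g (σ.spinorBundle Γ) γ → (∃ Δ, σ.HasConstantMatrices γ Δ) →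
        IsDiracStructure g (σ.spinorBundle Γ') γ' → (∃ Δ, σ.HasConstantMatrices γ' Δ) →
        ∃ (S : GL (Fin (dγ r s)) ℂ) (ε : ℂ) (T : ∀ x : M,
          (σ.spinorBundle Γ).Fiber x ≃ₗ[ℂ] (σ.spinorBundle Γ').Fiber x),
          (ε = 1 ∨ ε = -1) ∧ (Even (r + s) → ε = 1) ∧
          (∀ (x : M) (p : σ.bundle.Fiber x) (v : Fin (dγ r s) → ℂ),
            T x (σ.spinor Γ p v)
              = σ.spinor Γ' p ((S : Matrix (Fin (dγ r s)) (Fin (dγ r s)) ℂ) *ᵥ v)) ∧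
          ∀ (x : M) (X : TangentSpace (𝓡 (r + s)) x) (ψ : (σ.spinorBundle Γ).Fiber x),
            γ' x X (T x ψ) = ε • T x (γ x X ψ)) ∧
      -- in odd dimension the sign does occur: the opposite section is of the same kind, but it is
      -- not conjugate to the given one, not even at a single point
      (Odd (r + s) → ∀ (Γ : DiracMatrices r s) (γ : EndValuedForm r s (σ.spinorBundle Γ)),
        IsDiracStructure g (σ.spinorBundle Γ) γ → (∃ Δ, σ.HasConstantMatrices γ Δ) →
        IsDiracStructure g (σ.spinorBundle Γ) (-γ) ∧ (∃ Δ, σ.HasConstantMatrices (-γ) Δ) ∧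
        ∀ x : M, ¬ ∃ T : (σ.spinorBundle Γ).Fiber x ≃ₗ[ℂ] (σ.spinorBundle Γ).Fiber x,
          ∀ (X : TangentSpace (𝓡 (r + s)) x) (ψ : (σ.spinorBundle Γ).Fiber x),
            (-γ) x X (T ψ) = T (γ x X ψ))) ∧
    -- the case of a Spin^c structure
    (∀ σ : SpinCStructure.{u, w, w'} g o,
      (∀ Γ : DiracMatrices r s, ∃ γ : EndValuedForm r s (σ.spinorBundle Γ),
        IsDiracStructure g (σ.spinorBundle Γ) γ ∧ σ.HasConstantMatrices γ Γ.1 ∧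
        ∀ γ', σ.HasConstantMatrices γ' Γ.1 → γ' = γ) ∧
      (∀ (Γ Γ' : DiracMatrices r s) (γ : EndValuedForm r s (σ.spinorBundle Γ))
        (γ' : EndValuedForm r s (σ.spinorBundle Γ')),
        IsDiracStructure g (σ.spinorBundle Γ) γ → (∃ Δ, σ.HasConstantMatrices γ Δ) →
        IsDiracStructure g (σ.spinorBundle Γ') γ' → (∃ Δ, σ.HasConstantMatrices γ' Δ) →
        ∃ (S : GL (Fin (dγ r s)) ℂ) (ε : ℂ) (T : ∀ x : M,
          (σ.spinorBundle Γ).Fiber x ≃ₗ[ℂ] (σ.spinorBundle Γ').Fiber x),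
          (ε = 1 ∨ ε = -1) ∧ (Even (r + s) → ε = 1) ∧
          (∀ (x : M) (p : σ.bundle.Fiber x) (v : Fin (dγ r s) → ℂ),
            T x (σ.spinor Γ p v)
              = σ.spinor Γ' p ((S : Matrix (Fin (dγ r s)) (Fin (dγ r s)) ℂ) *ᵥ v)) ∧
          ∀ (x : M) (X : TangentSpace (𝓡 (r + s)) x) (ψ : (σ.spinorBundle Γ).Fiber x),
            γ' x X (T x ψ) = ε • T x (γ x X ψ)) ∧
      (Odd (r + s) → ∀ (Γ : DiracMatrices r s) (γ : EndValuedForm r s (σ.spinorBundle Γ)),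
        IsDiracStructure g (σ.spinorBundle Γ) γ → (∃ Δ, σ.HasConstantMatrices γ Δ) →
        IsDiracStructure g (σ.spinorBundle Γ) (-γ) ∧ (∃ Δ, σ.HasConstantMatrices (-γ) Δ) ∧
        ∀ x : M, ¬ ∃ T : (σ.spinorBundle Γ).Fiber x ≃ₗ[ℂ] (σ.spinorBundle Γ).Fiber x,
          ∀ (X : TangentSpace (𝓡 (r + s)) x) (ψ : (σ.spinorBundle Γ).Fiber x),
            (-γ) x X (T ψ) = T (γ x X ψ))) := by
  refine ⟨DiracMatrices.nonempty r s, fun σ => ⟨fun Γ => ?_, fun Γ Γ' γ γ' => ?_, fun hodd Γ γ => ?_⟩,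
    fun σ => ⟨fun Γ => ?_, fun Γ Γ' γ γ' => ?_, fun hodd Γ γ => ?_⟩⟩
  · exact ⟨σ.spinorFrames.diracForm Γ, σ.spinorFrames.isDiracStructure_diracForm,
      σ.spinorFrames.hasConstantMatrices_diracForm, fun γ' h =>
        SpinorFrames.HasConstantMatrices.eq_of σ.spinorFrames
          σ.spinorFrames.hasConstantMatrices_diracForm h⟩
  · exact σ.spinorFrames.exists_conj
  · exact σ.spinorFrames.neg_not_conj hodd
  · exact ⟨σ.spinorFrames.diracForm Γ, σ.spinorFrames.isDiracStructure_diracForm,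
      σ.spinorFrames.hasConstantMatrices_diracForm, fun γ' h =>
        SpinorFrames.HasConstantMatrices.eq_of σ.spinorFrames
          σ.spinorFrames.hasConstantMatrices_diracForm h⟩
  · exact σ.spinorFrames.exists_conj
  · exact σ.spinorFrames.neg_not_conj hodd
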